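/- Let $\Omega\subset\mathbb R^3$ be a bounded connected open set with Lipschitz boundary, let $\nu,\sigma>0$ be real numbers, and let $\boldsymbol\beta\in L^\infty(\Omega)^3$, with $\|\boldsymbol\beta\|_{\infty}:=\max_{i}\operatorname{ess\,sup}_\Omega|\beta_i|$, satisfy $$2\|\boldsymbol\beta\|_\infty^2<\nu\sigma .$$ Write $L^2_0(\Omega)$ for the functions in $L^2(\Omega)$ with mean value zero and $\|\cdot\|_0$ for the norms of $L^2(\Omega)$ and $L^2(\Omega)^3$, let curl and gradient be taken in the sense of distributions, and set $$\mathcal V:=\{(\boldsymbol\theta,q)\in L^2(\Omega)^3\times L^2_0(\Omega):\ \sqrt\nu\,\mathrm{curl}\,\boldsymbol\theta+\nabla q\in L^2(\Omega)^3\},$$ $$\|(\boldsymbol\theta,q)\|_{\mathcal V}:=\bigl(\sigma\|\boldsymbol\theta\|_0^2+\|\sqrt\nu\,\mathrm{curl}\,\boldsymbol\theta+\nabla q\|_0^2+\|q\|_0^2\bigr)^{1/2}.$$ Then $\mathcal V$ is a Hilbert space with this norm, and for every $\boldsymbol f\in L^2(\Omega)^3$ there is exactly one $(\boldsymbol\omega,p)\in\mathcal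 V$ such that, for all $(\boldsymbol\theta,q)\in\mathcal V$, $$\sigma\int_\Omega\boldsymbol\omega\cdot\boldsymbol\theta+\int_\Omega(\sqrt\nu\,\mathrm{curl}\,\boldsymbol\omega+\nabla p)\cdot(\sqrt\nu\,\mathrm{curl}\,\boldsymbol\theta+\nabla q)+\nu^{-1/2}\int_\Omega(\boldsymbol\omega\times\boldsymbol\beta)\cdot(\sqrt\nu\,\mathrm{curl}\,\boldsymbol\theta+\nabla q)=\int_\Omega\boldsymbol f\cdot(\sqrt\nu\,\mathrm{curl}\,\boldsymbol\theta+\nabla q).$$ The solution depends continuously on $\boldsymbol f$: there is a constant $C>0$, independent of the force, such that the solutions $(\boldsymbol\omega_1,p_1)$, $(\boldsymbol\omega_2,p_2)$ for any two forces $\boldsymbol f_1,\boldsymbol f_2\in L^2(\Omega)^3$ satisfy $$\|(\boldsymbol\omega_1-\boldsymbol\omega_2,\,p_1-p_2)\|_{\mathcal V}\le C\,\|\boldsymbol f_1-\boldsymbol f_2\|_0 .$$ -/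

import Mathlib

open MeasureTheory TopologicalSpace Set
open scoped ContDiff ENNReal Matrix

namespace Oseen

/-- Three-dimensional Euclidean space. -/
abbrev R3 := EuclideanSpace ℝ (Fin 3)

/-- `L²(Ω)³`, with norm `(∫_Ω |θ|²)^{1/2}`. -/
noncomputable abbrev L2Vec (Ω : Opens R3) := Lp R3 2 (volume.restrict (Ω : Set R3))

/-- `L²(Ω)`. -/
noncomputable abbrev L2 (Ω : Opens R3) := Lp ℝ 2 (volume.restrict (Ω : Set R3))

/-- `L^∞(Ω)³`. Since `Fin 3 → ℝ` carries the maximum norm, the norm of this space is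
`‖β‖ = max_i ess sup_Ω |β_i|`. -/
noncomputable abbrev LinftyVec (Ω : Opens R3) := Lp (Fin 3 → ℝ) ∞ (volume.restrict (Ω : Set R3))

/-- `Ω` has a Lipschitz boundary: near each boundary point, in suitable orthonormal coordinates
`(e y).fst ∈ ℝ²`, `(e y).snd ∈ ℝ`, the set `Ω` is the region strictly above the graph of a
Lipschitz function. -/
def HasLipschitzBoundary (Ω : Set R3) : Prop :=
  ∀ x ∈ frontier Ω, ∃ (e : R3 ≃ₗᵢ[ℝ] WithLp 2 (EuclideanSpace ℝ (Fin 2) × ℝ)) (K : NNReal)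
    (g : EuclideanSpace ℝ (Fin 2) → ℝ) (r : ℝ), LipschitzWith K g ∧ 0 < r ∧
      ∀ y ∈ Metric.ball x r, y ∈ Ω ↔ g (e y).fst < (e y).snd

/-- The partial derivative `∂_j ξ_i` at `x`. -/
noncomputable def pderiv (ξ : R3 → R3) (j i : Fin 3) (x : R3) : ℝ :=
  (fderiv ℝ ξ x (EuclideanSpace.single j 1)) i

/-- The classical curl of a differentiable vector field. -/
noncomputable def curl (ξ : R3 → R3) (x : R3) : R3 :=
  !₂[pderiv ξ 1 2 x - pderiv ξ 2 1 x, pderiv ξ 2 0 x - pderiv ξ 0 2 x,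
    pderiv ξ 0 1 x - pderiv ξ 1 0 x]

/-- The classical divergence of a differentiable vector field. -/
noncomputable def divergence (ξ : R3 → R3) (x : R3) : ℝ := ∑ i, pderiv ξ i i x

/-- `ξ ∈ 𝒟(Ω)³`: smooth with compact support contained in `Ω`. -/
structure IsTestField (Ω : Opens R3) (ξ : R3 → R3) : Prop where
  contDiff : ContDiff ℝ ∞ ξ
  hasCompactSupport : HasCompactSupport ξ
  tsupport_subset : tsupport ξ ⊆ (Ω : Set R3)

/-- `√ν curl θ + ∇q = w` in the sense of distributions on `Ω`. Neither `curl θ` nor `∇q` need be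
a function by itself. -/
def IsCurlAddGrad (Ω : Opens R3) (ν : ℝ) (θ : L2Vec Ω) (q : L2 Ω) (w : L2Vec Ω) : Prop :=
  ∀ ξ : R3 → R3, IsTestField Ω ξ →
    ∫ x in (Ω : Set R3), inner ℝ (w x) (ξ x) =
      √ν * (∫ x in (Ω : Set R3), inner ℝ (θ x) (curl ξ x))
        - ∫ x in (Ω : Set R3), q x * divergence ξ x

/-! ### The distributional operator is single-valued, linear and closed -/

theorem IsTestField.continuous_pderiv {Ω : Opens R3} {ξ : R3 → R3} (h : IsTestField Ω ξ)
    (j i : Fin 3) : Continuous (pderiv ξ j i) := by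
  have h1 : Continuous (fderiv ℝ ξ) := h.contDiff.continuous_fderiv (by simp)
  unfold pderiv
  fun_prop

theorem IsTestField.pderiv_eq_zero {Ω : Opens R3} {ξ : R3 → R3} (_h : IsTestField Ω ξ)
    (j i : Fin 3) {x : R3} (hx : x ∉ tsupport ξ) : pderiv ξ j i x = 0 := by
  have : fderiv ℝ ξ x = 0 := by
    by_contra hne
    exact hx (support_fderiv_subset ℝ (Function.mem_support.2 hne))
  simp [pderiv, this]

theorem IsTestField.memLp {Ω : Opens R3} {ξ : R3 → R3} (h : IsTestField Ω ξ) :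
    MemLp ξ 2 (volume.restrict (Ω : Set R3)) :=
  (h.contDiff.continuous.memLp_of_hasCompactSupport h.hasCompactSupport).restrict _

theorem IsTestField.memLp_curl {Ω : Opens R3} {ξ : R3 → R3} (h : IsTestField Ω ξ) :
    MemLp (curl ξ) 2 (volume.restrict (Ω : Set R3)) := by
  have hc : Continuous (curl ξ) := by
    have := h.continuous_pderiv
    unfold curl
    refine (PiLp.continuous_toLp 2 _).comp (continuous_pi fun i => ?_)
    fin_cases i <;> simp <;> exact (this _ _).sub (this _ _)
  refine (hc.memLp_of_hasCompactSupport
    (HasCompactSupport.intro h.hasCompactSupport fun x hx => ?_)).restrict _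
  ext i
  fin_cases i <;> simp [curl, h.pderiv_eq_zero _ _ hx]

theorem IsTestField.memLp_divergence {Ω : Opens R3} {ξ : R3 → R3} (h : IsTestField Ω ξ) :
    MemLp (divergence ξ) 2 (volume.restrict (Ω : Set R3)) := by
  have hc : Continuous (divergence ξ) :=
    continuous_finsetSum _ fun i _ => h.continuous_pderiv i i
  refine (hc.memLp_of_hasCompactSupport
    (HasCompactSupport.intro h.hasCompactSupport fun x hx => ?_)).restrict _
  simp [divergence, h.pderiv_eq_zero _ _ hx]

theorem isCurlAddGrad_iff {Ω : Opens R3} {ν : ℝ} {θ : L2Vec Ω} {q : L2 Ω} {w : L2Vec Ω} :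
    IsCurlAddGrad Ω ν θ q w ↔ ∀ (ξ : R3 → R3) (h : IsTestField Ω ξ),
      inner ℝ w (h.memLp.toLp ξ) = √ν * inner ℝ θ (h.memLp_curl.toLp _)
        - inner ℝ q (h.memLp_divergence.toLp _) := by
  refine forall_congr' fun ξ => forall_congr' fun h => ?_
  have e1 : inner ℝ w (h.memLp.toLp ξ) = ∫ x in (Ω : Set R3), inner ℝ (w x) (ξ x) := by
    rw [L2.inner_def]
    refine integral_congr_ae ?_
    filter_upwards [h.memLp.coeFn_toLp] with x hx
    rw [hx]
  have e2 : inner ℝ θ (h.memLp_curl.toLp _) =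
      ∫ x in (Ω : Set R3), inner ℝ (θ x) (curl ξ x) := by
    rw [L2.inner_def]
    refine integral_congr_ae ?_
    filter_upwards [h.memLp_curl.coeFn_toLp] with x hx
    rw [hx]
  have e3 : inner ℝ q (h.memLp_divergence.toLp _) =
      ∫ x in (Ω : Set R3), q x * divergence ξ x := by
    rw [L2.inner_def]
    refine integral_congr_ae ?_
    filter_upwards [h.memLp_divergence.coeFn_toLp] with x hx
    rw [hx]
    simp [mul_comm]
  rw [e1, e2, e3]

theorem IsCurlAddGrad.add {Ω : Opens R3} {ν : ℝ} {θ θ' : L2Vec Ω} {q q' : L2 Ω} {w w' : L2Vec Ω}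
    (h : IsCurlAddGrad Ω ν θ q w) (h' : IsCurlAddGrad Ω ν θ' q' w') :
    IsCurlAddGrad Ω ν (θ + θ') (q + q') (w + w') := by
  rw [isCurlAddGrad_iff] at *
  intro ξ hξ
  simp only [inner_add_left, h ξ hξ, h' ξ hξ]
  ring

theorem IsCurlAddGrad.smul {Ω : Opens R3} {ν : ℝ} {θ : L2Vec Ω} {q : L2 Ω} {w : L2Vec Ω}
    (c : ℝ) (h : IsCurlAddGrad Ω ν θ q w) :
    IsCurlAddGrad Ω ν (c • θ) (c • q) (c • w) := by
  rw [isCurlAddGrad_iff] at *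
  intro ξ hξ
  simp only [real_inner_smul_left, h ξ hξ]
  ring

theorem IsCurlAddGrad.zero (Ω : Opens R3) (ν : ℝ) : IsCurlAddGrad Ω ν 0 0 0 := by
  rw [isCurlAddGrad_iff]
  intro ξ hξ
  simp only [inner_zero_left]
  ring

theorem IsCurlAddGrad.eq_zero {Ω : Opens R3} {ν : ℝ} {w : L2Vec Ω}
    (h : IsCurlAddGrad Ω ν 0 0 w) : w = 0 := by
  rw [isCurlAddGrad_iff] at h
  have hloc : LocallyIntegrable w (volume.restrict (Ω : Set R3)) :=
    (Lp.memLp w).locallyIntegrable (by norm_num)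
  have key := Ω.isOpen.ae_eq_zero_of_integral_contDiff_smul_eq_zero
    (hloc.locallyIntegrableOn (Ω : Set R3)) (fun g hg hgc hgs => by
      refine ext_inner_left ℝ fun c => ?_
      have ht : IsTestField Ω (fun x => g x • c) :=
        ⟨hg.smul contDiff_const, hgc.smul_right,
          (closure_mono (Function.support_smul_subset_left g _)).trans hgs⟩
      have h0 := h _ ht
      simp only [inner_zero_left, mul_zero, sub_zero] at h0
      rw [L2.inner_def] at h0
      have hint : Integrable (fun x => g x • w x) (volume.restrict (Ω : Set R3)) :=
        hloc.integrable_smul_left_of_hasCompactSupport hg.continuous hgc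
      rw [← integral_inner hint, inner_zero_right, ← h0]
      refine integral_congr_ae ?_
      filter_upwards [ht.memLp.coeFn_toLp] with x hx
      rw [hx, real_inner_smul_right, real_inner_smul_right, real_inner_comm])
  refine (Lp.eq_zero_iff_ae_eq_zero).2 ?_
  filter_upwards [key, ae_restrict_mem Ω.isOpen.measurableSet] with x hx hm
  exact hx hm

theorem IsCurlAddGrad.unique {Ω : Opens R3} {ν : ℝ} {θ : L2Vec Ω} {q : L2 Ω} {w w' : L2Vec Ω}
    (h : IsCurlAddGrad Ω ν θ q w) (h' : IsCurlAddGrad Ω ν θ q w') : w = w' := by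
  have h1 := h.add (h'.smul (-1))
  simp only [neg_smul, one_smul, add_neg_cancel] at h1
  have h2 := h1.eq_zero
  rwa [add_neg_eq_zero] at h2

/-! ### The space `𝒱` -/

/-- The vector space of all `(θ, q) ∈ L²(Ω)³ × L²(Ω)` with `∫_Ω q = 0` and
`√ν curl θ + ∇q ∈ L²(Ω)³`. For bounded `Ω` the functions of `L²(Ω)` are integrable; integrability
is written out so that the set is a vector space for every open `Ω`. -/
def spaceSubmodule (Ω : Opens R3) (ν : ℝ) : Submodule ℝ (L2Vec Ω × L2 Ω) where
  carrier := {u | (Integrable u.2 (volume.restrict (Ω : Set R3)) ∧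
    ∫ x in (Ω : Set R3), u.2 x = 0) ∧ ∃ w : L2Vec Ω, IsCurlAddGrad Ω ν u.1 u.2 w}
  zero_mem' := by
    refine ⟨⟨(integrable_zero _ _ _).congr (Lp.coeFn_zero _ _ _).symm, ?_⟩,
      0, IsCurlAddGrad.zero Ω ν⟩
    rw [Prod.snd_zero, integral_congr_ae (Lp.coeFn_zero ℝ 2 (volume.restrict (Ω : Set R3)))]
    simp
  add_mem' := by
    rintro u v ⟨⟨hu, hu0⟩, w, hw⟩ ⟨⟨hv, hv0⟩, w', hw'⟩
    refine ⟨⟨(hu.add hv).congr (Lp.coeFn_add _ _).symm, ?_⟩, w + w', hw.add hw'⟩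
    rw [Prod.snd_add, integral_congr_ae (Lp.coeFn_add _ _)]
    simp only [Pi.add_apply]
    rw [integral_add hu hv, hu0, hv0, add_zero]
  smul_mem' := by
    rintro c u ⟨⟨hu, hu0⟩, w, hw⟩
    refine ⟨⟨(hu.smul c).congr (Lp.coeFn_smul _ _).symm, ?_⟩, c • w, hw.smul c⟩
    rw [Prod.smul_snd, integral_congr_ae (Lp.coeFn_smul _ _)]
    simp only [Pi.smul_apply]
    rw [integral_smul, hu0, smul_zero]

/-- The space `𝒱`; the parameter `σ > 0` only enters through the norm. -/
def Space (Ω : Opens R3) (ν σ : ℝ) (_hσ : 0 < σ) : Type := spaceSubmodule Ω ν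

namespace Space

variable {Ω : Opens R3} {ν σ : ℝ} {hσ : 0 < σ}

noncomputable instance : AddCommGroup (Space Ω ν σ hσ) := inferInstanceAs
  (AddCommGroup (spaceSubmodule Ω ν))

noncomputable instance : Module ℝ (Space Ω ν σ hσ) :=
  inferInstanceAs (Module ℝ (spaceSubmodule Ω ν))

/-- The first component `θ` of `(θ, q)`. -/
def vort (u : Space Ω ν σ hσ) : L2Vec Ω := (Subtype.val u : L2Vec Ω × L2 Ω).1

/-- The second component `q` of `(θ, q)`. -/
def press (u : Space Ω ν σ hσ) : L2 Ω := (Subtype.val u : L2Vec Ω × L2 Ω).2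

/-- The field `√ν curl θ + ∇q ∈ L²(Ω)³` of `(θ, q)`. -/
noncomputable def curlGrad (u : Space Ω ν σ hσ) : L2Vec Ω :=
  Classical.choose (Subtype.property u).2

theorem curlGrad_spec (u : Space Ω ν σ hσ) : IsCurlAddGrad Ω ν u.vort u.press u.curlGrad :=
  Classical.choose_spec (Subtype.property u).2

@[ext] theorem ext {u v : Space Ω ν σ hσ} (h : u.vort = v.vort) (h' : u.press = v.press) :
    u = v := Subtype.ext (Prod.ext h h')

@[simp] theorem vort_add (u v : Space Ω ν σ hσ) : (u + v).vort = u.vort + v.vort := rfl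
@[simp] theorem press_add (u v : Space Ω ν σ hσ) : (u + v).press = u.press + v.press := rfl
@[simp] theorem vort_smul (c : ℝ) (u : Space Ω ν σ hσ) : (c • u).vort = c • u.vort := rfl
@[simp] theorem press_smul (c : ℝ) (u : Space Ω ν σ hσ) : (c • u).press = c • u.press := rfl

@[simp] theorem curlGrad_add (u v : Space Ω ν σ hσ) :
    (u + v).curlGrad = u.curlGrad + v.curlGrad :=
  (curlGrad_spec (u + v)).unique (u.curlGrad_spec.add v.curlGrad_spec)

@[simp] theorem curlGrad_smul (c : ℝ) (u : Space Ω ν σ hσ) :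
    (c • u).curlGrad = c • u.curlGrad :=
  (curlGrad_spec (c • u)).unique (u.curlGrad_spec.smul c)

/-- The inner product of `𝒱`. -/
@[reducible] noncomputable def core : InnerProductSpace.Core ℝ (Space Ω ν σ hσ) where
  inner u v := σ * inner ℝ u.vort v.vort + inner ℝ u.curlGrad v.curlGrad +
    inner ℝ u.press v.press
  conj_inner_symm u v := by
    simp [real_inner_comm]
  re_inner_nonneg u := by
    have h1 := real_inner_self_nonneg (x := u.vort)
    have h2 := real_inner_self_nonneg (x := u.curlGrad)
    have h3 := real_inner_self_nonneg (x := u.press)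
    simp only [RCLike.re_to_real]
    positivity
  add_left u v w := by
    simp only [vort_add, press_add, curlGrad_add, inner_add_left]
    ring
  smul_left u v c := by
    simp only [vort_smul, press_smul, curlGrad_smul, real_inner_smul_left, conj_trivial]
    ring
  definite u h := by
    have h1 := real_inner_self_nonneg (x := u.vort)
    have h2 := real_inner_self_nonneg (x := u.curlGrad)
    have h3 := real_inner_self_nonneg (x := u.press)
    have h4 := mul_nonneg hσ.le h1
    refine Space.ext ?_ ?_
    · have : σ * inner ℝ u.vort u.vort = 0 := by linarith
      exact inner_self_eq_zero.1 ((mul_eq_zero.1 this).resolve_left hσ.ne')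
    · have : inner ℝ u.press u.press = (0 : ℝ) := by linarith
      exact inner_self_eq_zero.1 this

noncomputable instance : NormedAddCommGroup (Space Ω ν σ hσ) :=
  (core (Ω := Ω) (ν := ν) (σ := σ) (hσ := hσ)).toNormedAddCommGroup

noncomputable instance : InnerProductSpace ℝ (Space Ω ν σ hσ) :=
  InnerProductSpace.ofCore (core (Ω := Ω) (ν := ν) (σ := σ) (hσ := hσ)).toCore

/-- The norm of `𝒱` is `(σ‖θ‖² + ‖√ν curl θ + ∇q‖² + ‖q‖²)^{1/2}`. -/
theorem norm_sq (u : Space Ω ν σ hσ) :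
    ‖u‖ ^ 2 = σ * ‖u.vort‖ ^ 2 + ‖u.curlGrad‖ ^ 2 + ‖u.press‖ ^ 2 := by
  rw [← real_inner_self_eq_norm_sq, ← real_inner_self_eq_norm_sq, ← real_inner_self_eq_norm_sq,
    ← real_inner_self_eq_norm_sq]
  rfl

end Space

/-! ### The weak formulation -/

/-- `𝒜((ω,p),(θ,q)) = σ∫ω·θ + ∫(√ν curl ω + ∇p)·(√ν curl θ + ∇q)
+ ν^{-1/2} ∫(ω × β)·(√ν curl θ + ∇q)`. -/
noncomputable def formA {Ω : Opens R3} {ν σ : ℝ} {hσ : 0 < σ} (β : LinftyVec Ω)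
    (u v : Space Ω ν σ hσ) : ℝ :=
  σ * (∫ x in (Ω : Set R3), inner ℝ (u.vort x) (v.vort x))
    + (∫ x in (Ω : Set R3), inner ℝ (u.curlGrad x) (v.curlGrad x))
    + (√ν)⁻¹ * ∫ x in (Ω : Set R3), ((u.vort x).ofLp ⨯₃ β x) ⬝ᵥ (v.curlGrad x).ofLp

/-- `ℱ(θ,q) = ∫ f·(√ν curl θ + ∇q)`. -/
noncomputable def formF {Ω : Opens R3} {ν σ : ℝ} {hσ : 0 < σ} (f : L2Vec Ω)
    (v : Space Ω ν σ hσ) : ℝ :=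
  ∫ x in (Ω : Set R3), inner ℝ (f x) (v.curlGrad x)

/-- `u = (ω,p) ∈ 𝒱` is a weak solution with convecting velocity `β` and force `f`. -/
def IsWeakSolution {Ω : Opens R3} {ν σ : ℝ} {hσ : 0 < σ} (β : LinftyVec Ω) (f : L2Vec Ω)
    (u : Space Ω ν σ hσ) : Prop :=
  ∀ v : Space Ω ν σ hσ, formA β u v = formF f v

end Oseen

/-!
The form `𝒜` only sees `θ` and the field `w = √ν curl θ + ∇q`. Pointwise `|ω × β| ≤ √3 ‖β‖ |ω|`, so
under the smallness condition on `β` it controls `‖θ‖² + ‖w‖²` (`exists_le_formL`). Everything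
then follows from the Lax–Milgram theorem, once the pressure is bounded by the other two quantities,
`‖q‖ ≤ C (‖θ‖ + ‖w‖)` for all `(θ, q) ∈ 𝒱` (`exists_norm_press_le`). This bound is where
boundedness, connectedness and the Lipschitz boundary are needed. It is proved in two steps, without
solving a divergence equation.

* The weighted gradient estimate `‖d ∇q‖ ≤ C (‖θ‖ + ‖w‖)`, where `d` is the distance to the
  complement of `Ω` (`exists_weightedGradBound`). Test `w = √ν curl θ + ∇q` with `d² ∇q`.
  As `curl ∇q = 0`, one has `curl (d² ∇q) = 2 d ∇d × ∇q`, and no second derivative of `q` appears: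
  `‖d ∇q‖² = ∫ w · d² ∇q - √ν ∫ θ · (2 d ∇d × ∇q)`, and `|∇d| ≤ 1`. To make this rigorous, `q` is
  replaced by its mollifications and `d` by a smooth cutoff function.

* The improved Poincaré inequality `‖q - c‖ ≤ C ‖d ∇q‖` on bounded connected Lipschitz domains
  (`poincareOn_self`). The sets on which it holds can be glued along overlaps of positive
  measure (`PoincareOn.union`), so that by compactness and connectedness only small pieces matter.
  On interior balls it is the ordinary Poincaré inequality, proved by translations
  (`exists_poincareOn_ball`). On boundary patches it follows from a Hardy inequality in the direction
  transversal to the boundary, the height above the graph being comparable with `d`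
  (`exists_poincareOn_boundary`); the terms caused by the cutoff function live in a compact subset of
  `Ω`, where the inequality is already known.
-/

namespace Oseen

section WellPosedness

/-! ### Multiplication by the convecting velocity -/

theorem norm_cross_le {M : ℝ} (a : R3) {b : Fin 3 → ℝ} (hb : ∀ i, |b i| ≤ M) :
    ‖WithLp.toLp 2 (a.ofLp ⨯₃ b)‖ ≤ √3 * M * ‖a‖ := by
  have hM : 0 ≤ M := (abs_nonneg _).trans (hb 0)
  refine le_of_sq_le_sq ?_ (by positivity)
  rw [EuclideanSpace.norm_sq_eq, mul_pow, mul_pow, Real.sq_sqrt (by norm_num),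
    EuclideanSpace.norm_sq_eq]
  have h := fun i => sq_le_sq' (abs_le.1 (hb i)).1 (abs_le.1 (hb i)).2
  simp only [cross_apply, Fin.sum_univ_three, Real.norm_eq_abs, sq_abs]
  simp only [Matrix.cons_val]
  have h3 : b 0 ^ 2 + b 1 ^ 2 + b 2 ^ 2 ≤ 3 * M ^ 2 := by linarith [h 0, h 1, h 2]
  have := mul_le_mul_of_nonneg_right h3
    (by positivity : 0 ≤ a.ofLp 0 ^ 2 + a.ofLp 1 ^ 2 + a.ofLp 2 ^ 2)
  nlinarith [sq_nonneg (a.ofLp 0 * b 0 + a.ofLp 1 * b 1 + a.ofLp 2 * b 2)]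

variable {Ω : Opens R3}

theorem ae_abs_le_norm (β : LinftyVec Ω) :
    ∀ᵐ x ∂(volume.restrict (Ω : Set R3)), ∀ i, |β x i| ≤ ‖β‖ := by
  have h1 : ∀ᵐ x ∂(volume.restrict (Ω : Set R3)), ‖β x‖ ≤ ‖β‖ := by
    have := ae_le_eLpNormEssSup (f := β) (μ := volume.restrict (Ω : Set R3))
    filter_upwards [this] with x hx
    rw [Lp.norm_def, eLpNorm_exponent_top, ← toReal_enorm]
    refine ENNReal.toReal_mono ?_ hx
    simpa [eLpNorm_exponent_top] using Lp.eLpNorm_ne_top β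
  filter_upwards [h1] with x hx i
  exact (norm_le_pi_norm (β x) i).trans hx

theorem aestronglyMeasurable_cross (β : LinftyVec Ω) (θ : L2Vec Ω) :
    AEStronglyMeasurable (fun x => (WithLp.toLp 2 ((θ x).ofLp ⨯₃ β x) : R3))
      (volume.restrict (Ω : Set R3)) := by
  have hc : Continuous fun p : R3 × (Fin 3 → ℝ) => (WithLp.toLp 2 (p.1.ofLp ⨯₃ p.2) : R3) := by
    refine (PiLp.continuous_toLp 2 _).comp (continuous_pi fun i => ?_)
    simp only [cross_apply]
    fin_cases i <;> simp <;> fun_prop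
  exact hc.comp_aestronglyMeasurable
    ((Lp.aestronglyMeasurable θ).prodMk (Lp.aestronglyMeasurable β))

theorem ae_norm_cross_le (β : LinftyVec Ω) (θ : L2Vec Ω) :
    ∀ᵐ x ∂(volume.restrict (Ω : Set R3)),
      ‖(WithLp.toLp 2 ((θ x).ofLp ⨯₃ β x) : R3)‖ ≤ √3 * ‖β‖ * ‖θ x‖ := by
  filter_upwards [ae_abs_le_norm β] with x hx
  exact norm_cross_le (θ x) hx

theorem memLp_cross (β : LinftyVec Ω) (θ : L2Vec Ω) :
    MemLp (fun x => (WithLp.toLp 2 ((θ x).ofLp ⨯₃ β x) : R3)) 2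
      (volume.restrict (Ω : Set R3)) :=
  (Lp.memLp θ).of_le_mul (aestronglyMeasurable_cross β θ) (ae_norm_cross_le β θ)

/-- The bounded operator `θ ↦ θ × β` on `L²(Ω)³`. -/
noncomputable def crossL (β : LinftyVec Ω) : L2Vec Ω →L[ℝ] L2Vec Ω :=
  LinearMap.mkContinuous
    { toFun := fun θ => (memLp_cross β θ).toLp _
      map_add' := fun θ θ' => by
        rw [← MemLp.toLp_add]
        refine MemLp.toLp_congr _ _ ?_
        filter_upwards [Lp.coeFn_add θ θ'] with x hx
        simp only [hx, Pi.add_apply, WithLp.ofLp_add, map_add, LinearMap.add_apply,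
          WithLp.toLp_add]
      map_smul' := fun c θ => by
        rw [RingHom.id_apply, ← MemLp.toLp_const_smul]
        refine MemLp.toLp_congr _ _ ?_
        filter_upwards [Lp.coeFn_smul c θ] with x hx
        simp only [hx, Pi.smul_apply, WithLp.ofLp_smul, map_smul, LinearMap.smul_apply,
          WithLp.toLp_smul] }
    (√3 * ‖β‖) fun θ => by
      refine Lp.norm_le_mul_norm_of_ae_le_mul ?_
      filter_upwards [ae_norm_cross_le β θ, (memLp_cross β θ).coeFn_toLp] with x hx h
      simpa [h] using hx

theorem norm_crossL_le (β : LinftyVec Ω) (θ : L2Vec Ω) :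
    ‖crossL β θ‖ ≤ √3 * ‖β‖ * ‖θ‖ :=
  (crossL β).le_of_opNorm_le (LinearMap.mkContinuous_norm_le _ (by positivity) _) θ

theorem inner_crossL (β : LinftyVec Ω) (θ w : L2Vec Ω) :
    inner ℝ (crossL β θ) w =
      ∫ x in (Ω : Set R3), ((θ x).ofLp ⨯₃ β x) ⬝ᵥ (w x).ofLp := by
  rw [L2.inner_def]
  refine integral_congr_ae ?_
  filter_upwards [(memLp_cross β θ).coeFn_toLp] with x hx
  have : crossL β θ x = (WithLp.toLp 2 ((θ x).ofLp ⨯₃ β x) : R3) := hx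
  rw [this, EuclideanSpace.inner_eq_star_dotProduct, dotProduct_comm]
  rfl

/-! ### The Hilbert space structure of `𝒱` -/

namespace Space

variable {ν σ : ℝ} {hσ : 0 < σ}

theorem sqrt_mul_norm_vort_le (u : Space Ω ν σ hσ) : √σ * ‖u.vort‖ ≤ ‖u‖ := by
  refine le_of_sq_le_sq ?_ (norm_nonneg u)
  rw [mul_pow, Real.sq_sqrt hσ.le, norm_sq]
  nlinarith [sq_nonneg ‖u.curlGrad‖, sq_nonneg ‖u.press‖]

theorem norm_curlGrad_le (u : Space Ω ν σ hσ) : ‖u.curlGrad‖ ≤ ‖u‖ := by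
  refine le_of_sq_le_sq ?_ (norm_nonneg u)
  rw [norm_sq]
  nlinarith [mul_nonneg hσ.le (sq_nonneg ‖u.vort‖), sq_nonneg ‖u.press‖]

theorem norm_press_le (u : Space Ω ν σ hσ) : ‖u.press‖ ≤ ‖u‖ := by
  refine le_of_sq_le_sq ?_ (norm_nonneg u)
  rw [norm_sq]
  nlinarith [mul_nonneg hσ.le (sq_nonneg ‖u.vort‖), sq_nonneg ‖u.curlGrad‖]

/-- The projection `(θ, q) ↦ θ`. -/
noncomputable def vortL : Space Ω ν σ hσ →L[ℝ] L2Vec Ω :=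
  LinearMap.mkContinuous { toFun := vort, map_add' := vort_add, map_smul' := vort_smul } (√σ)⁻¹
    fun u => by
      have := Real.sqrt_pos.2 hσ
      rw [inv_mul_eq_div, le_div_iff₀ this, mul_comm]
      exact sqrt_mul_norm_vort_le u

/-- The map `(θ, q) ↦ √ν curl θ + ∇q`. -/
noncomputable def curlGradL : Space Ω ν σ hσ →L[ℝ] L2Vec Ω :=
  LinearMap.mkContinuous
    { toFun := curlGrad, map_add' := curlGrad_add, map_smul' := curlGrad_smul } 1
    fun u => by simpa using norm_curlGrad_le u

/-- The projection `(θ, q) ↦ q`. -/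
noncomputable def pressL : Space Ω ν σ hσ →L[ℝ] L2 Ω :=
  LinearMap.mkContinuous { toFun := press, map_add' := press_add, map_smul' := press_smul } 1
    fun u => by simpa using norm_press_le u

@[simp] theorem vortL_apply (u : Space Ω ν σ hσ) : vortL u = u.vort := rfl
@[simp] theorem curlGradL_apply (u : Space Ω ν σ hσ) : curlGradL u = u.curlGrad := rfl
@[simp] theorem pressL_apply (u : Space Ω ν σ hσ) : pressL u = u.press := rfl

/-- `𝒱` is complete because the distributional operator `(θ, q) ↦ √ν curl θ + ∇q` is closed. -/
theorem completeSpace (hΩ : Bornology.IsBounded (Ω : Set R3)) :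
    CompleteSpace (Space Ω ν σ hσ) := by
  have hfin : IsFiniteMeasure (volume.restrict (Ω : Set R3)) :=
    isFiniteMeasure_restrict.2 hΩ.measure_lt_top.ne
  refine Metric.complete_of_cauchySeq_tendsto fun u hu => ?_
  obtain ⟨θ, hθ⟩ := cauchySeq_tendsto_of_complete
    ((vortL (Ω := Ω) (ν := ν) (hσ := hσ)).uniformContinuous.comp_cauchySeq hu)
  obtain ⟨w, hw⟩ := cauchySeq_tendsto_of_complete
    ((curlGradL (Ω := Ω) (ν := ν) (hσ := hσ)).uniformContinuous.comp_cauchySeq hu)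
  obtain ⟨q, hq⟩ := cauchySeq_tendsto_of_complete
    ((pressL (Ω := Ω) (ν := ν) (hσ := hσ)).uniformContinuous.comp_cauchySeq hu)
  have hcg : IsCurlAddGrad Ω ν θ q w := by
    rw [isCurlAddGrad_iff]
    intro ξ hξ
    have h1 := fun n => isCurlAddGrad_iff.1 (u n).curlGrad_spec ξ hξ
    refine tendsto_nhds_unique (hw.inner tendsto_const_nhds) ?_
    refine Filter.Tendsto.congr (fun n => (h1 n).symm) ?_
    exact ((hθ.inner tendsto_const_nhds).const_mul _).sub (hq.inner tendsto_const_nhds)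
  have hmean : ∫ x in (Ω : Set R3), q x = 0 := by
    have e : ∀ p : L2 Ω, ∫ x in (Ω : Set R3), p x =
        inner ℝ (indicatorConstLp 2 MeasurableSet.univ
          (measure_ne_top (volume.restrict (Ω : Set R3)) univ) (1 : ℝ)) p := fun p => by
      rw [L2.inner_indicatorConstLp_one]
      simp
    rw [e]
    refine tendsto_nhds_unique (tendsto_const_nhds.inner hq) ?_
    refine Filter.Tendsto.congr (fun n => ?_) tendsto_const_nhds
    refine Eq.trans ?_ (e _)
    exact (Subtype.property (u n)).1.2.symm
  have hint : Integrable q (volume.restrict (Ω : Set R3)) :=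
    (Lp.memLp q).integrable (by norm_num)
  let v : Space Ω ν σ hσ := ⟨(θ, q), ⟨hint, hmean⟩, w, hcg⟩
  have hv : v.curlGrad = w := v.curlGrad_spec.unique hcg
  refine ⟨v, tendsto_iff_norm_sub_tendsto_zero.2 ?_⟩
  have hsq : ∀ n, ‖u n - v‖ = √(σ * ‖vortL (u n) - θ‖ ^ 2 + ‖curlGradL (u n) - w‖ ^ 2 +
      ‖pressL (u n) - q‖ ^ 2) := fun n => by
    rw [← Real.sqrt_sq (norm_nonneg (u n - v)), norm_sq]
    have e1 : (u n - v).vort = vortL (u n) - θ := map_sub vortL (u n) v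
    have e2 : (u n - v).curlGrad = curlGradL (u n) - w := by
      rw [← hv]; exact map_sub curlGradL (u n) v
    have e3 : (u n - v).press = pressL (u n) - q := map_sub pressL (u n) v
    rw [e1, e2, e3]
  simp_rw [hsq]
  have hθ' := (tendsto_iff_norm_sub_tendsto_zero.1 hθ).pow 2
  have hw' := (tendsto_iff_norm_sub_tendsto_zero.1 hw).pow 2
  have hq' := (tendsto_iff_norm_sub_tendsto_zero.1 hq).pow 2
  have := (((hθ'.const_mul σ).add hw').add hq').sqrt
  simpa using this

end Space

/-! ### Coercivity and the Lax–Milgram theorem -/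

section LaxMilgram

variable {ν σ : ℝ} {hσ : 0 < σ}

/-- The form `𝒜` as a bounded bilinear form on `𝒱`. -/
noncomputable def formL (β : LinftyVec Ω) :
    Space Ω ν σ hσ →L[ℝ] Space Ω ν σ hσ →L[ℝ] ℝ :=
  σ • (innerSL ℝ (E := L2Vec Ω)).bilinearComp Space.vortL Space.vortL +
    (innerSL ℝ (E := L2Vec Ω)).bilinearComp Space.curlGradL Space.curlGradL +
    (√ν)⁻¹ • (innerSL ℝ (E := L2Vec Ω)).bilinearComp ((crossL β).comp Space.vortL)
      Space.curlGradL

theorem formL_apply_eq_inner (β : LinftyVec Ω) (u v : Space Ω ν σ hσ) :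
    formL β u v = σ * inner ℝ u.vort v.vort + inner ℝ u.curlGrad v.curlGrad +
      (√ν)⁻¹ * inner ℝ (crossL β u.vort) v.curlGrad := by
  simp [formL, ContinuousLinearMap.bilinearComp_apply]

theorem formL_apply (β : LinftyVec Ω) (u v : Space Ω ν σ hσ) :
    formL β u v = formA β u v := by
  rw [formL_apply_eq_inner, inner_crossL, L2.inner_def, L2.inner_def]
  rfl

theorem formF_eq_inner (f : L2Vec Ω) (v : Space Ω ν σ hσ) :
    formF f v = inner ℝ f v.curlGrad := by
  rw [L2.inner_def]
  rfl

/-- Since `|ω × β| ≤ √3 ‖β‖ |ω|`, the form controls `‖ω‖² + ‖√ν curl ω + ∇p‖²`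
as soon as `3 ‖β‖² < 4 ν σ`. -/
theorem exists_le_formL (hν : 0 < ν) {β : LinftyVec Ω} (hβ : 2 * ‖β‖ ^ 2 < ν * σ) :
    ∃ c : ℝ, 0 < c ∧ ∀ u : Space Ω ν σ hσ,
      c * (‖u.vort‖ ^ 2 + ‖u.curlGrad‖ ^ 2) ≤ formL β u u := by
  refine ⟨min (σ / 4) (1 / 2), by positivity, fun u => ?_⟩
  rw [formL_apply_eq_inner, real_inner_self_eq_norm_sq, real_inner_self_eq_norm_sq]
  have h1 : |inner ℝ (crossL β u.vort) u.curlGrad| ≤ √3 * ‖β‖ * ‖u.vort‖ * ‖u.curlGrad‖ :=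
    (abs_real_inner_le_norm _ _).trans (by gcongr; exact norm_crossL_le β u.vort)
  set a := ‖u.vort‖
  set b := ‖u.curlGrad‖
  set t := √3 * ‖β‖ * (√ν)⁻¹ with ht
  have ht2 : t ^ 2 ≤ 3 / 2 * σ := by
    rw [ht, mul_pow, mul_pow, inv_pow, Real.sq_sqrt hν.le, Real.sq_sqrt (by norm_num),
      ← div_eq_mul_inv, div_le_iff₀ hν]
    linarith
  have h2 : -(t * a * b) ≤ (√ν)⁻¹ * inner ℝ (crossL β u.vort) u.curlGrad := by
    have h3 := mul_le_mul_of_nonneg_left (abs_le.1 h1).1 (by positivity : 0 ≤ (√ν)⁻¹)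
    calc -(t * a * b) = (√ν)⁻¹ * -(√3 * ‖β‖ * a * b) := by rw [ht]; ring
      _ ≤ _ := h3
  have h4 : min (σ / 4) (1 / 2) * (a ^ 2 + b ^ 2) ≤ σ / 4 * a ^ 2 + 1 / 2 * b ^ 2 := by
    rw [mul_add]
    gcongr
    · exact min_le_left _ _
    · exact min_le_right _ _
  nlinarith [sq_nonneg (t * a - b), mul_le_mul_of_nonneg_right ht2 (sq_nonneg a)]

theorem isCoercive_formL (hν : 0 < ν) {β : LinftyVec Ω} (hβ : 2 * ‖β‖ ^ 2 < ν * σ) {C : ℝ}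
    (hC : ∀ u : Space Ω ν σ hσ, ‖u.press‖ ≤ C * (‖u.vort‖ + ‖u.curlGrad‖)) :
    IsCoercive (formL (Ω := Ω) (ν := ν) (σ := σ) (hσ := hσ) β) := by
  obtain ⟨c, hc, h⟩ := exists_le_formL (hσ := hσ) hν hβ
  have hK : 0 < σ + 1 + 2 * C ^ 2 := by positivity
  refine ⟨c / (σ + 1 + 2 * C ^ 2), by positivity, fun u => ?_⟩
  rw [mul_assoc, ← sq, Space.norm_sq, div_mul_eq_mul_div, div_le_iff₀ hK]
  have h1 : ‖u.press‖ ^ 2 ≤ 2 * C ^ 2 * (‖u.vort‖ ^ 2 + ‖u.curlGrad‖ ^ 2) := by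
    have := pow_le_pow_left₀ (norm_nonneg _) (hC u) 2
    nlinarith [mul_nonneg (sq_nonneg C) (sq_nonneg (‖u.vort‖ - ‖u.curlGrad‖))]
  have h2 := mul_le_mul_of_nonneg_right (h u) hK.le
  refine le_trans ?_ h2
  rw [mul_assoc c]
  gcongr
  nlinarith [sq_nonneg ‖u.vort‖, sq_nonneg ‖u.curlGrad‖,
    mul_nonneg hσ.le (sq_nonneg ‖u.curlGrad‖)]

/-- Well-posedness, given the bound `‖q‖ ≤ C (‖θ‖ + ‖√ν curl θ + ∇q‖)` on `𝒱`. -/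
theorem wellPosed_of_norm_press_le (hΩ : Bornology.IsBounded (Ω : Set R3)) (hν : 0 < ν)
    {β : LinftyVec Ω} (hβ : 2 * ‖β‖ ^ 2 < ν * σ) {C : ℝ}
    (hC : ∀ u : Space Ω ν σ hσ, ‖u.press‖ ≤ C * (‖u.vort‖ + ‖u.curlGrad‖)) :
    (∀ f : L2Vec Ω, ∃! u : Space Ω ν σ hσ, IsWeakSolution β f u) ∧
    ∃ C : ℝ, 0 < C ∧ ∀ (f₁ f₂ : L2Vec Ω) (u₁ u₂ : Space Ω ν σ hσ),
      IsWeakSolution β f₁ u₁ → IsWeakSolution β f₂ u₂ → ‖u₁ - u₂‖ ≤ C * ‖f₁ - f₂‖ := by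
  have := Space.completeSpace (ν := ν) (hσ := hσ) hΩ
  have hco := isCoercive_formL hν hβ hC
  have hstab : ∃ C : ℝ, 0 < C ∧ ∀ (f₁ f₂ : L2Vec Ω) (u₁ u₂ : Space Ω ν σ hσ),
      IsWeakSolution β f₁ u₁ → IsWeakSolution β f₂ u₂ → ‖u₁ - u₂‖ ≤ C * ‖f₁ - f₂‖ := by
    obtain ⟨c, hc, h⟩ := hco
    refine ⟨c⁻¹, by positivity, fun f₁ f₂ u₁ u₂ h₁ h₂ => ?_⟩
    rw [inv_mul_eq_div, le_div_iff₀ hc, mul_comm]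
    rcases eq_or_lt_of_le (norm_nonneg (u₁ - u₂)) with h0 | h0
    · rw [← h0, mul_zero]; positivity
    refine le_of_mul_le_mul_right ((h (u₁ - u₂)).trans ?_) h0
    have e : formL β (u₁ - u₂) (u₁ - u₂) = inner ℝ (f₁ - f₂) (u₁ - u₂).curlGrad := by
      rw [map_sub (formL β) u₁ u₂, sub_apply, formL_apply, formL_apply, h₁, h₂, formF_eq_inner,
        formF_eq_inner, inner_sub_left]
    rw [e]
    exact (real_inner_le_norm _ _).trans
      (mul_le_mul_of_nonneg_left (Space.norm_curlGrad_le _) (norm_nonneg _))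
  refine ⟨fun f => ?_, hstab⟩
  let ℓ : Space Ω ν σ hσ →L[ℝ] ℝ := (innerSL ℝ f).comp Space.curlGradL
  let z := (InnerProductSpace.toDual ℝ (Space Ω ν σ hσ)).symm ℓ
  refine ⟨hco.continuousLinearEquivOfBilin.symm z, fun v => ?_, fun u hu => ?_⟩
  · rw [← formL_apply, ← hco.continuousLinearEquivOfBilin_apply,
      ContinuousLinearEquiv.apply_symm_apply, InnerProductSpace.toDual_symm_apply,
      formF_eq_inner]
    rfl
  · rw [ContinuousLinearEquiv.eq_symm_apply, eq_comm]
    refine hco.unique_continuousLinearEquivOfBilin fun v => ?_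
    rw [InnerProductSpace.toDual_symm_apply, formL_apply, hu v, formF_eq_inner]
    rfl

end LaxMilgram

end WellPosedness

/-! ### Mollification and cutoff functions -/

section Mollify

open scoped Convolution

/-- The convolution of `q` with the normalised bump function `φ`. -/
noncomputable def mollify (φ : ContDiffBump (0 : R3)) (q : R3 → ℝ) : R3 → ℝ :=
  φ.normed volume ⋆[ContinuousLinearMap.lsmul ℝ ℝ, volume] q

theorem mollify_apply (φ : ContDiffBump (0 : R3)) (q : R3 → ℝ) (x : R3) :
    mollify φ q x = ∫ t, φ.normed volume t * q (x - t) := rfl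

theorem contDiff_mollify (φ : ContDiffBump (0 : R3)) {q : R3 → ℝ}
    (hq : LocallyIntegrable q volume) : ContDiff ℝ ∞ (mollify φ q) :=
  φ.hasCompactSupport_normed.contDiff_convolution_left _ φ.contDiff_normed hq

/-- Averages of translations of `D` have the same Lipschitz constant as `D`. -/
theorem lipschitzWith_mollify (φ : ContDiffBump (0 : R3)) {D : R3 → ℝ} (hD : LipschitzWith 1 D) :
    LipschitzWith 1 (mollify φ D) := by
  refine LipschitzWith.of_dist_le_mul fun x y => ?_
  have hi : ∀ x, Integrable fun t => φ.normed volume t * D (x - t) := fun x =>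
    ((φ.continuous_normed (μ := volume)).mul (hD.continuous.comp (by fun_prop))).integrable_of_hasCompactSupport
      φ.hasCompactSupport_normed.mul_right
  rw [mollify_apply, mollify_apply, Real.dist_eq, ← integral_sub (hi x) (hi y),
    NNReal.coe_one, one_mul]
  calc |∫ t, φ.normed volume t * D (x - t) - φ.normed volume t * D (y - t)|
      ≤ ∫ t, φ.normed volume t * dist x y := by
        rw [← Real.norm_eq_abs]
        refine norm_integral_le_of_norm_le ((φ.integrable_normed (μ := volume)).mul_const _) ?_
        refine Filter.Eventually.of_forall fun t => ?_
        rw [← mul_sub, norm_mul, Real.norm_of_nonneg (φ.nonneg_normed t)]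
        refine mul_le_mul_of_nonneg_left ?_ (φ.nonneg_normed t)
        have := hD.dist_le_mul (x - t) (y - t)
        simpa [Real.dist_eq] using this
    _ = dist x y := by rw [integral_mul_const, φ.integral_normed, one_mul]

/-- A smooth substitute for `(dist(·, Ωᶜ) - 4ε)₊` that is supported at distance `2ε` from `Ωᶜ`:
the mollification of `(dist(·, Ωᶜ) - 3ε)₊`. -/
theorem exists_smooth_cutoff {Ω : Set R3} (hb : Bornology.IsBounded Ω) (φ : ContDiffBump (0 : R3)) :
    ∃ ψ : R3 → ℝ, ContDiff ℝ ∞ ψ ∧ HasCompactSupport ψ ∧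
      tsupport ψ ⊆ {x | 2 * φ.rOut ≤ Metric.infDist x Ωᶜ} ∧ (∀ x, ‖fderiv ℝ ψ x‖ ≤ 1) ∧
      ∀ x, max (Metric.infDist x Ωᶜ - 4 * φ.rOut) 0 ≤ ψ x ∧ ψ x ≤ Metric.infDist x Ωᶜ := by
  set ε := φ.rOut
  have hε : 0 < ε := φ.rOut_pos
  have hlip := Metric.lipschitz_infDist_pt Ωᶜ
  set D : R3 → ℝ := fun x => max (Metric.infDist x Ωᶜ - 3 * ε) 0 with hD
  have hDlip : LipschitzWith 1 D := by
    refine LipschitzWith.of_dist_le_mul fun x y => ?_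
    have h1 := hlip.dist_le_mul x y
    rw [Real.dist_eq] at h1 ⊢
    refine (abs_max_sub_max_le_abs _ _ _).trans ?_
    simpa using h1
  have hDlip' : ∀ x y, |D x - D y| ≤ dist x y := fun x y => by
    simpa [Real.dist_eq] using hDlip.dist_le_mul x y
  have hdlip' : ∀ x y, |Metric.infDist x Ωᶜ - Metric.infDist y Ωᶜ| ≤ dist x y := fun x y => by
    simpa [Real.dist_eq] using hlip.dist_le_mul x y
  have hd0 : ∀ x, 0 ≤ Metric.infDist x Ωᶜ := fun x => Metric.infDist_nonneg
  have hclose : ∀ x, |mollify φ D x - D x| ≤ ε := fun x => by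
    rw [← Real.dist_eq]
    refine φ.dist_normed_convolution_le hDlip.continuous.aestronglyMeasurable fun y hy => ?_
    rw [Real.dist_eq]
    exact (hDlip' y x).trans (Metric.mem_ball.1 hy).le
  have hzero : ∀ x, Metric.infDist x Ωᶜ < 2 * ε → mollify φ D x = 0 := fun x hx => by
    have h0 : ∀ y ∈ Metric.ball x ε, D y = 0 := fun y hy => by
      have h1 := (abs_le.1 (hdlip' y x)).2
      have h2 := Metric.mem_ball.1 hy
      exact max_eq_right (by linarith)
    have hx0 := h0 x (Metric.mem_ball_self hε)
    have := φ.normed_convolution_eq_right (μ := volume) (g := D) (x₀ := x)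
      fun y hy => by rw [h0 y hy, hx0]
    rw [← hx0]
    exact this
  have hsupp : tsupport (mollify φ D) ⊆ {x | 2 * ε ≤ Metric.infDist x Ωᶜ} := by
    refine closure_minimal (fun x hx => ?_)
      (isClosed_le continuous_const (Metric.continuous_infDist_pt _))
    by_contra hlt
    exact hx (hzero x (not_le.1 hlt))
  refine ⟨mollify φ D, contDiff_mollify φ hDlip.continuous.locallyIntegrable, ?_, hsupp,
    fun x => ?_, fun x => ⟨?_, ?_⟩⟩
  · refine Metric.isCompact_of_isClosed_isBounded (isClosed_tsupport _)
      (hb.subset fun x hx => ?_)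
    by_contra hxΩ
    have := hsupp hx
    rw [mem_ofPred_eq, Metric.infDist_zero_of_mem (mem_compl hxΩ)] at this
    linarith
  · simpa using norm_fderiv_le_of_lipschitz ℝ (x₀ := x) (lipschitzWith_mollify φ hDlip)
  · have h1 := (abs_le.1 (hclose x)).1
    refine max_le ?_ ?_
    · have : Metric.infDist x Ωᶜ - 3 * ε ≤ D x := le_max_left _ _
      linarith
    · rw [mollify_apply]
      exact integral_nonneg fun t => mul_nonneg (φ.nonneg_normed t) (le_max_right _ _)
  · rcases lt_or_ge (Metric.infDist x Ωᶜ) (2 * ε) with h | h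
    · rw [hzero x h]; exact hd0 x
    · have h1 := (abs_le.1 (hclose x)).2
      have : D x ≤ Metric.infDist x Ωᶜ - ε := max_le (by linarith) (by linarith)
      linarith

/-- Mollification is moved from `q` to translations of the test function `g`. -/
theorem integral_mollify_mul (φ : ContDiffBump (0 : R3)) {q g : R3 → ℝ} (hq : Integrable q)
    (hg : Continuous g) (hgc : HasCompactSupport g) :
    ∫ x, mollify φ q x * g x = ∫ t, φ.normed volume t * ∫ x, q x * g (x + t) := by
  obtain ⟨B, hB⟩ := hg.bounded_above_of_compact_support hgc
  have hint : Integrable (fun p : R3 × R3 => (φ.normed volume p.2 * q (p.1 - p.2)) * g p.1)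
      (volume.prod volume) := by
    refine Integrable.mul_bdd (c := B) ?_ (hg.comp continuous_fst).aestronglyMeasurable
      (Filter.Eventually.of_forall fun p => hB p.1)
    exact φ.integrable_normed.convolution_integrand (ContinuousLinearMap.lsmul ℝ ℝ) hq
  calc ∫ x, mollify φ q x * g x
      = ∫ x, ∫ t, (φ.normed volume t * q (x - t)) * g x := by
        refine integral_congr_ae (Filter.Eventually.of_forall fun x => ?_)
        simp only [mollify_apply, integral_mul_const]
    _ = ∫ t, ∫ x, (φ.normed volume t * q (x - t)) * g x := integral_integral_swap hint
    _ = _ := by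
        refine integral_congr_ae (Filter.Eventually.of_forall fun t => ?_)
        simp only [mul_assoc, integral_const_mul]
        congr 1
        rw [← integral_sub_right_eq_self (fun x => q x * g (x + t)) t]
        simp

end Mollify

/-! ### Test fields -/

theorem pderiv_comp_add_right (ξ : R3 → R3) (y : R3) (j i : Fin 3) (x : R3) :
    pderiv (fun x => ξ (x + y)) j i x = pderiv ξ j i (x + y) := by
  rw [pderiv, pderiv, fderiv_comp_add_right]

theorem curl_comp_add_right (ξ : R3 → R3) (y : R3) :
    curl (fun x => ξ (x + y)) = fun x => curl ξ (x + y) := by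
  ext1 x
  simp only [curl, pderiv_comp_add_right]

theorem divergence_comp_add_right (ξ : R3 → R3) (y : R3) :
    divergence (fun x => ξ (x + y)) = fun x => divergence ξ (x + y) := by
  ext1 x
  simp only [divergence, pderiv_comp_add_right]

/-- Test fields supported at distance `2ε` from `Ωᶜ` can be translated by vectors of length `ε`. -/
theorem IsTestField.comp_add_right {Ω : Opens R3} {ξ : R3 → R3} (h : IsTestField Ω ξ) {ε : ℝ}
    (hε : 0 < ε) (hs : tsupport ξ ⊆ {x | 2 * ε ≤ Metric.infDist x (Ω : Set R3)ᶜ}) {y : R3}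
    (hy : ‖y‖ ≤ ε) : IsTestField Ω (fun x => ξ (x + y)) where
  contDiff := h.contDiff.comp (contDiff_id.add contDiff_const)
  hasCompactSupport := h.hasCompactSupport.comp_homeomorph (Homeomorph.addRight y)
  tsupport_subset := by
    intro x hx
    have h1 : x + y ∈ tsupport ξ :=
      tsupport_comp_subset_preimage ξ (continuous_id.add continuous_const) hx
    by_contra hxΩ
    have h2 : 2 * ε ≤ Metric.infDist (x + y) (Ω : Set R3)ᶜ := hs h1
    have h3 := Metric.infDist_le_dist_of_mem (x := x + y) (mem_compl hxΩ)
    rw [dist_eq_norm, add_sub_cancel_left] at h3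
    linarith

theorem abs_setIntegral_inner_le {Ω : Opens R3} (w : L2Vec Ω) {g : R3 → R3}
    (hg : MemLp g 2 volume) :
    |∫ x in (Ω : Set R3), inner ℝ (w x) (g x)| ≤ ‖w‖ * (eLpNorm g 2 volume).toReal := by
  have hg' := hg.restrict (Ω : Set R3)
  have e : ∫ x in (Ω : Set R3), inner ℝ (w x) (g x) = inner ℝ w (hg'.toLp g) := by
    rw [L2.inner_def]
    refine integral_congr_ae ?_
    filter_upwards [hg'.coeFn_toLp] with x hx
    rw [hx]
  rw [e]
  refine (abs_real_inner_le_norm _ _).trans ?_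
  rw [Lp.norm_toLp]
  gcongr
  · exact hg.eLpNorm_ne_top
  · exact Measure.restrict_le_self

theorem _root_.ContDiff.continuous_curl {ξ : R3 → R3} (h : ContDiff ℝ ∞ ξ) :
    Continuous (curl ξ) := by
  have h1 : Continuous (fderiv ℝ ξ) := h.continuous_fderiv (by simp)
  unfold curl pderiv
  refine (PiLp.continuous_toLp 2 _).comp (continuous_pi fun i => ?_)
  fin_cases i <;> simp <;> fun_prop

theorem IsTestField.memLp_volume {Ω : Opens R3} {ξ : R3 → R3} (h : IsTestField Ω ξ) :
    MemLp ξ 2 volume :=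
  h.contDiff.continuous.memLp_of_hasCompactSupport h.hasCompactSupport

theorem IsTestField.memLp_curl_volume {Ω : Opens R3} {ξ : R3 → R3} (h : IsTestField Ω ξ) :
    MemLp (curl ξ) 2 volume := by
  refine h.contDiff.continuous_curl.memLp_of_hasCompactSupport
    (HasCompactSupport.intro h.hasCompactSupport fun x hx => ?_)
  ext i
  fin_cases i <;> simp [curl, h.pderiv_eq_zero _ _ hx]

theorem IsTestField.continuous_divergence {Ω : Opens R3} {ξ : R3 → R3} (h : IsTestField Ω ξ) :
    Continuous (divergence ξ) :=
  continuous_finsetSum _ fun i _ => h.continuous_pderiv i i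

theorem IsTestField.hasCompactSupport_divergence {Ω : Opens R3} {ξ : R3 → R3}
    (h : IsTestField Ω ξ) : HasCompactSupport (divergence ξ) :=
  HasCompactSupport.intro h.hasCompactSupport fun x hx => by
    simp [divergence, h.pderiv_eq_zero _ _ hx]

theorem IsCurlAddGrad.abs_integral_mul_divergence_le {Ω : Opens R3} {ν : ℝ} {θ : L2Vec Ω}
    {q : L2 Ω} {w : L2Vec Ω} (h : IsCurlAddGrad Ω ν θ q w) {ξ : R3 → R3} (hξ : IsTestField Ω ξ) :
    |∫ x in (Ω : Set R3), q x * divergence ξ x| ≤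
      ‖w‖ * (eLpNorm ξ 2 volume).toReal + √ν * (‖θ‖ * (eLpNorm (curl ξ) 2 volume).toReal) := by
  have h1 := abs_setIntegral_inner_le w hξ.memLp_volume
  have h2 := abs_setIntegral_inner_le θ hξ.memLp_curl_volume
  have h3 := h ξ hξ
  have h4 : ∫ x in (Ω : Set R3), q x * divergence ξ x =
      √ν * (∫ x in (Ω : Set R3), inner ℝ (θ x) (curl ξ x)) -
        ∫ x in (Ω : Set R3), inner ℝ (w x) (ξ x) := by rw [h3]; ring
  rw [h4]
  refine (abs_sub _ _).trans ?_
  rw [abs_mul, abs_of_nonneg (Real.sqrt_nonneg ν), add_comm]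
  gcongr

/-- The bound for `∫ q div ξ` is inherited by the mollifications of `q`, because it holds for all
translations of `ξ` by vectors of length at most `ε` with the same constants. -/
theorem IsCurlAddGrad.abs_integral_mollify_mul_divergence_le {Ω : Opens R3}
    (hΩ : Bornology.IsBounded (Ω : Set R3)) {ν : ℝ} {θ : L2Vec Ω}
    {q : L2 Ω} {w : L2Vec Ω} (h : IsCurlAddGrad Ω ν θ q w) (φ : ContDiffBump (0 : R3))
    {ξ : R3 → R3} (hξ : IsTestField Ω ξ)
    (hs : tsupport ξ ⊆ {x | 2 * φ.rOut ≤ Metric.infDist x (Ω : Set R3)ᶜ}) :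
    |∫ x, mollify φ ((Ω : Set R3).indicator q) x * divergence ξ x| ≤
      ‖w‖ * (eLpNorm ξ 2 volume).toReal + √ν * (‖θ‖ * (eLpNorm (curl ξ) 2 volume).toReal) := by
  have hfin : IsFiniteMeasure (volume.restrict (Ω : Set R3)) :=
    isFiniteMeasure_restrict.2 hΩ.measure_lt_top.ne
  have hq : Integrable ((Ω : Set R3).indicator q) :=
    IntegrableOn.integrable_indicator ((Lp.memLp q).integrable (by norm_num))
      Ω.isOpen.measurableSet
  rw [integral_mollify_mul φ hq hξ.continuous_divergence hξ.hasCompactSupport_divergence]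
  set K := ‖w‖ * (eLpNorm ξ 2 volume).toReal +
    √ν * (‖θ‖ * (eLpNorm (curl ξ) 2 volume).toReal) with hK
  have key : ∀ t, φ.normed volume t ≠ 0 →
      |∫ x, (Ω : Set R3).indicator q x * divergence ξ (x + t)| ≤ K := fun t ht => by
    have ht' : ‖t‖ ≤ φ.rOut := by
      have : t ∈ Function.support (φ.normed volume) := ht
      rw [φ.support_normed_eq, mem_ball_zero_iff] at this
      exact this.le
    have h1 := h.abs_integral_mul_divergence_le (hξ.comp_add_right φ.rOut_pos hs ht')
    rw [divergence_comp_add_right, curl_comp_add_right,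
      ← Function.comp_def ξ (fun x => x + t), ← Function.comp_def (curl ξ) (fun x => x + t),
      eLpNorm_comp_measurePreserving hξ.memLp_volume.aestronglyMeasurable
        (measurePreserving_add_right volume t),
      eLpNorm_comp_measurePreserving hξ.memLp_curl_volume.aestronglyMeasurable
        (measurePreserving_add_right volume t)] at h1
    refine le_of_eq_of_le ?_ h1
    rw [← integral_indicator Ω.isOpen.measurableSet]
    congr 2
    ext x
    by_cases hx : x ∈ (Ω : Set R3) <;> simp [hx]
  calc |∫ t, φ.normed volume t * ∫ x, (Ω : Set R3).indicator q x * divergence ξ (x + t)|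
      ≤ ∫ t, φ.normed volume t * K := by
        rw [← Real.norm_eq_abs]
        refine norm_integral_le_of_norm_le ((φ.integrable_normed (μ := volume)).mul_const _) ?_
        refine Filter.Eventually.of_forall fun t => ?_
        rw [norm_mul, Real.norm_of_nonneg (φ.nonneg_normed t)]
        by_cases ht : φ.normed volume t = 0
        · simp [ht]
        · exact mul_le_mul_of_nonneg_left (key t ht) (φ.nonneg_normed t)
    _ = K := by rw [integral_mul_const, φ.integral_normed, one_mul]

/-! ### The weighted gradient estimate -/

theorem toDual_symm_apply_coord (L : R3 →L[ℝ] ℝ) (i : Fin 3) :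
    (InnerProductSpace.toDual ℝ R3).symm L i = L (EuclideanSpace.single i 1) := by
  rw [← InnerProductSpace.toDual_symm_apply (𝕜 := ℝ) (y := L), EuclideanSpace.inner_single_right,
    one_mul]
  rfl

theorem sum_sq_apply_single (L : R3 →L[ℝ] ℝ) :
    ∑ i, L (EuclideanSpace.single i 1) ^ 2 = ‖L‖ ^ 2 := by
  rw [← (InnerProductSpace.toDual ℝ R3).symm.norm_map L, EuclideanSpace.norm_sq_eq]
  refine Finset.sum_congr rfl fun i _ => ?_
  rw [toDual_symm_apply_coord, Real.norm_eq_abs, sq_abs]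

theorem gradient_apply (f : R3 → ℝ) (x : R3) (i : Fin 3) :
    gradient f x i = fderiv ℝ f x (EuclideanSpace.single i 1) :=
  toDual_symm_apply_coord _ i

theorem norm_gradient (f : R3 → ℝ) (x : R3) : ‖gradient f x‖ = ‖fderiv ℝ f x‖ :=
  (InnerProductSpace.toDual ℝ R3).symm.norm_map _

theorem contDiff_gradient {f : R3 → ℝ} (hf : ContDiff ℝ ∞ f) : ContDiff ℝ ∞ (gradient f) :=
  (InnerProductSpace.toDual ℝ R3).symm.toContinuousLinearEquiv.contDiff.comp
    (hf.fderiv_right (by simp))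

theorem pderiv_eq {ξ : R3 → R3} {x : R3} (h : DifferentiableAt ℝ ξ x) (j i : Fin 3) :
    pderiv ξ j i x = fderiv ℝ (fun y => ξ y i) x (EuclideanSpace.single j 1) := by
  have h1 : HasFDerivAt (fun y => ξ y i)
      ((EuclideanSpace.proj (𝕜 := ℝ) i).comp (fderiv ℝ ξ x)) x :=
    (EuclideanSpace.proj (𝕜 := ℝ) (i : Fin 3) : R3 →L[ℝ] ℝ).hasFDerivAt.comp x h.hasFDerivAt
  rw [h1.fderiv]
  rfl

/-- Integration by parts against a compactly supported field. -/
theorem integral_mul_divergence {f : R3 → ℝ} (hf : ContDiff ℝ ∞ f) {ξ : R3 → R3}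
    (hξ : ContDiff ℝ ∞ ξ) (hc : HasCompactSupport ξ) :
    ∫ x, f x * divergence ξ x = -∫ x, inner ℝ (gradient f x) (ξ x) := by
  have hi : ∀ i, ContDiff ℝ ∞ (fun x => ξ x i) := fun i =>
    (EuclideanSpace.proj (𝕜 := ℝ) (i : Fin 3) : R3 →L[ℝ] ℝ).contDiff.comp hξ
  have hci : ∀ i, HasCompactSupport (fun x => ξ x i) := fun i =>
    hc.comp_left (g := fun v : R3 => v i) rfl
  have hfd : Continuous (fderiv ℝ f) := hf.continuous_fderiv (by simp)
  have hgd : ∀ i, Continuous (fderiv ℝ (fun x => ξ x i)) := fun i =>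
    (hi i).continuous_fderiv (by simp)
  have I1 : ∀ i, Integrable fun x =>
      fderiv ℝ f x (EuclideanSpace.single i 1) * ξ x i := fun i =>
    ((hfd.clm_apply continuous_const).mul (hi i).continuous).integrable_of_hasCompactSupport
      (hci i).mul_left
  have I2 : ∀ i, Integrable fun x =>
      f x * fderiv ℝ (fun x => ξ x i) x (EuclideanSpace.single i 1) := fun i =>
    (hf.continuous.mul ((hgd i).clm_apply continuous_const)).integrable_of_hasCompactSupport
      ((hci i).fderiv_apply ℝ _).mul_left
  have e1 : ∀ x, f x * divergence ξ x =
      ∑ i, f x * fderiv ℝ (fun x => ξ x i) x (EuclideanSpace.single i 1) := fun x => by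
    rw [divergence, Finset.mul_sum]
    refine Finset.sum_congr rfl fun i _ => ?_
    rw [pderiv_eq (hξ.differentiable (by simp) x)]
  have e2 : ∀ x, inner ℝ (gradient f x) (ξ x) =
      ∑ i, fderiv ℝ f x (EuclideanSpace.single i 1) * ξ x i := fun x => by
    rw [PiLp.inner_apply]
    refine Finset.sum_congr rfl fun i _ => ?_
    rw [gradient_apply]
    simp [mul_comm]
  simp_rw [e1, e2]
  rw [integral_finsetSum _ fun i _ => I2 i, integral_finsetSum _ fun i _ => I1 i,
    ← Finset.sum_neg_distrib]
  refine Finset.sum_congr rfl fun i _ => ?_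
  exact integral_mul_fderiv_eq_neg_fderiv_mul_of_integrable (I1 i) (I2 i)
    ((hf.continuous.mul (hi i).continuous).integrable_of_hasCompactSupport (hci i).mul_left)
    (fun x _ => hf.differentiable (by simp) x) (fun x _ => (hi i).differentiable (by simp) x)

/-- As `curl ∇f = 0`, the curl of `ψ² ∇f` contains no second derivatives of `f`. -/
theorem norm_curl_sq_smul_gradient_le {f ψ : R3 → ℝ} (hf : ContDiff ℝ ∞ f)
    (hψ : ContDiff ℝ ∞ ψ) (x : R3) :
    ‖curl (fun y => ψ y ^ 2 • gradient f y) x‖ ≤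
      2 * |ψ x| * ‖fderiv ℝ ψ x‖ * ‖fderiv ℝ f x‖ := by
  have hψd : HasFDerivAt ψ (fderiv ℝ ψ x) x := (hψ.differentiable (by simp) x).hasFDerivAt
  have hfd : HasFDerivAt (fderiv ℝ f) (fderiv ℝ (fderiv ℝ f) x) x :=
    ((hf.fderiv_right (m := ∞) (by simp)).differentiable (by simp) x).hasFDerivAt
  have hsymm : IsSymmSndFDerivAt ℝ f x := 
    (hf.of_le (m := 2) (WithTop.coe_le_coe.2 le_top)).contDiffAt.isSymmSndFDerivAt (by simp)
  have hd : DifferentiableAt ℝ (fun y => ψ y ^ 2 • gradient f y) x :=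
    (((hψ.pow 2).smul (contDiff_gradient hf)).differentiable (by simp)) x
  set e : Fin 3 → R3 := fun i => EuclideanSpace.single i 1 with he
  have hp : ∀ j i, pderiv (fun y => ψ y ^ 2 • gradient f y) j i x =
      ψ x ^ 2 * fderiv ℝ (fderiv ℝ f) x (e j) (e i) +
        2 * ψ x * (fderiv ℝ ψ x (e j) * fderiv ℝ f x (e i)) := fun j i => by
    rw [pderiv_eq hd]
    have h1 : (fun y => (ψ y ^ 2 • gradient f y) i) = fun y => ψ y ^ 2 * fderiv ℝ f y (e i) := by
      ext y
      simp [gradient_apply, he]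
    have h2 : HasFDerivAt (fun y => ψ y ^ 2 * fderiv ℝ f y (e i)) _ x :=
      (hψd.pow 2).mul (hfd.clm_apply (hasFDerivAt_const (e i) x))
    rw [h1, h2.fderiv]
    simp [he]
    ring
  refine le_of_sq_le_sq ?_ (by positivity)
  have ha := sum_sq_apply_single (fderiv ℝ ψ x)
  have hb := sum_sq_apply_single (fderiv ℝ f x)
  have s01 := hsymm (e 0) (e 1)
  have s02 := hsymm (e 0) (e 2)
  have s12 := hsymm (e 1) (e 2)
  rw [mul_pow, mul_pow, mul_pow, sq_abs, ← ha, ← hb, EuclideanSpace.norm_sq_eq]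
  simp only [curl, Fin.sum_univ_three, Real.norm_eq_abs, sq_abs, Matrix.cons_val, hp, s01, s02, s12]
  change _ ≤ 2 ^ 2 * ψ x ^ 2 * (fderiv ℝ ψ x (e 0) ^ 2 + fderiv ℝ ψ x (e 1) ^ 2 +
    fderiv ℝ ψ x (e 2) ^ 2) * (fderiv ℝ f x (e 0) ^ 2 + fderiv ℝ f x (e 1) ^ 2 +
    fderiv ℝ f x (e 2) ^ 2)
  generalize fderiv ℝ ψ x (e 0) = a0
  generalize fderiv ℝ ψ x (e 1) = a1
  generalize fderiv ℝ ψ x (e 2) = a2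
  generalize fderiv ℝ f x (e 0) = b0
  generalize fderiv ℝ f x (e 1) = b1
  generalize fderiv ℝ f x (e 2) = b2
  -- Lagrange's identity `|a|² |b|² - |a × b|² = (a · b)²`
  linear_combination (norm := (apply le_of_eq; ring_nf))
    4 * sq_nonneg (ψ x * (a0 * b0 + a1 * b1 + a2 * b2))

/-- The weighted gradient bound `‖dist(·, Ωᶜ) ∇q‖ ≤ M` for `q ∈ L²`, expressed through the
mollifications of `q` at scale `ε`, with the weight cut down to `(dist(·, Ωᶜ) - 4ε)₊`. -/
def WeightedGradBound (Ω : Set R3) (q : R3 → ℝ) (M : NNReal) : Prop :=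
  ∀ φ : ContDiffBump (0 : R3),
    eLpNorm (fun x => max (Metric.infDist x Ωᶜ - 4 * φ.rOut) 0 * ‖fderiv ℝ (mollify φ q) x‖)
      2 volume ≤ M

theorem exists_infDist_compl_le {Ω : Set R3} (hΩ : Bornology.IsBounded Ω) :
    ∃ R : ℝ, 0 ≤ R ∧ ∀ x, Metric.infDist x Ωᶜ ≤ R := by
  obtain ⟨ρ, hρ, hΩρ⟩ := hΩ.subset_ball_lt 0 0
  have hp : EuclideanSpace.single (0 : Fin 3) ρ ∈ Ωᶜ := fun h => by
    have := mem_ball_zero_iff.1 (hΩρ h)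
    rw [PiLp.norm_single, Real.norm_of_nonneg hρ.le] at this
    exact lt_irrefl _ this
  refine ⟨2 * ρ, by positivity, fun x => ?_⟩
  by_cases hx : x ∈ Ω
  · refine (Metric.infDist_le_dist_of_mem hp).trans ?_
    rw [dist_eq_norm]
    refine (norm_sub_le _ _).trans ?_
    rw [PiLp.norm_single, Real.norm_of_nonneg hρ.le]
    linarith [mem_ball_zero_iff.1 (hΩρ hx)]
  · rw [Metric.infDist_zero_of_mem (mem_compl hx)]
    positivity

/-- Testing with `ψ² ∇q`, where `ψ` is a smooth substitute for the distance to `Ωᶜ`, bounds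
`∫ ψ² |∇q|²`: `curl (ψ² ∇q) = 2 ψ ∇ψ × ∇q` is of size `2 ψ |∇q|`. -/
theorem exists_weightedGradBound {Ω : Opens R3} (hΩ : Bornology.IsBounded (Ω : Set R3)) (ν : ℝ) :
    ∃ R : ℝ, 0 ≤ R ∧ ∀ (θ : L2Vec Ω) (q : L2 Ω) (w : L2Vec Ω), IsCurlAddGrad Ω ν θ q w →
      WeightedGradBound Ω ((Ω : Set R3).indicator q)
        (Real.toNNReal (R * ‖w‖ + 2 * √ν * ‖θ‖)) := by
  obtain ⟨R, hR, hdR⟩ := exists_infDist_compl_le hΩ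
  refine ⟨R, hR, fun θ q w h φ => ?_⟩
  have hfin : IsFiniteMeasure (volume.restrict (Ω : Set R3)) :=
    isFiniteMeasure_restrict.2 hΩ.measure_lt_top.ne
  have hq : Integrable ((Ω : Set R3).indicator q) :=
    IntegrableOn.integrable_indicator ((Lp.memLp q).integrable (by norm_num))
      Ω.isOpen.measurableSet
  obtain ⟨ψ, hψ, hψc, hψs, hψ1, hψb⟩ := exists_smooth_cutoff hΩ φ
  have hψ0 : ∀ x, 0 ≤ ψ x := fun x => (le_max_right _ _).trans (hψb x).1
  set f := mollify φ ((Ω : Set R3).indicator q) with hf_def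
  have hf : ContDiff ℝ ∞ f := contDiff_mollify φ hq.locallyIntegrable
  set ξ : R3 → R3 := fun x => ψ x ^ 2 • gradient f x with hξ_def
  have hξs : tsupport ξ ⊆ tsupport ψ := by
    refine closure_mono fun x hx => ?_
    contrapose! hx
    simp [hξ_def, Function.notMem_support.1 hx]
  have hξΩ : IsTestField Ω ξ := by
    refine ⟨(hψ.pow 2).smul (contDiff_gradient hf),
      hψc.of_isClosed_subset (isClosed_tsupport _) hξs, fun x hx => ?_⟩
    by_contra hxΩ
    have := hψs (hξs hx)
    rw [mem_ofPred_eq, Metric.infDist_zero_of_mem (mem_compl hxΩ)] at this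
    linarith [φ.rOut_pos]
  have hfd : Continuous (fderiv ℝ f) := hf.continuous_fderiv (by simp)
  set u : R3 → ℝ := fun x => ψ x * ‖fderiv ℝ f x‖ with hu_def
  have hu0 : ∀ x, 0 ≤ u x := fun x => mul_nonneg (hψ0 x) (norm_nonneg _)
  have hu : MemLp u 2 volume :=
    (hψ.continuous.mul hfd.norm).memLp_of_hasCompactSupport hψc.mul_right
  have hX : (eLpNorm u 2 volume).toReal ^ 2 = ∫ x, inner ℝ (gradient f x) (ξ x) := by
    rw [← Lp.norm_toLp u hu, ← real_inner_self_eq_norm_sq, L2.inner_def]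
    refine integral_congr_ae ?_
    filter_upwards [hu.coeFn_toLp] with x hx
    rw [hx, real_inner_self_eq_norm_sq, real_inner_smul_right, real_inner_self_eq_norm_sq,
      norm_gradient, hu_def, Real.norm_eq_abs, sq_abs, mul_pow]
  have hξn : (eLpNorm ξ 2 volume).toReal ≤ R * (eLpNorm u 2 volume).toReal := by
    have := eLpNorm_le_mul_eLpNorm_of_ae_le_mul (μ := volume) (f := ξ) (g := u) (c := R)
      (Filter.Eventually.of_forall fun x => ?_) 2
    · refine (ENNReal.toReal_mono (ENNReal.mul_ne_top ENNReal.ofReal_ne_top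
        hu.eLpNorm_ne_top) this).trans ?_
      rw [ENNReal.toReal_mul, ENNReal.toReal_ofReal hR]
    · rw [Real.norm_of_nonneg (hu0 x), norm_smul, norm_gradient, norm_pow,
        Real.norm_of_nonneg (hψ0 x), sq, mul_assoc]
      exact mul_le_mul_of_nonneg_right ((hψb x).2.trans (hdR x)) (hu0 x)
  have hcn : (eLpNorm (curl ξ) 2 volume).toReal ≤ 2 * (eLpNorm u 2 volume).toReal := by
    have := eLpNorm_le_mul_eLpNorm_of_ae_le_mul (μ := volume) (f := curl ξ) (g := u) (c := 2)
      (Filter.Eventually.of_forall fun x => ?_) 2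
    · refine (ENNReal.toReal_mono (ENNReal.mul_ne_top ENNReal.ofReal_ne_top
        hu.eLpNorm_ne_top) this).trans ?_
      rw [ENNReal.toReal_mul, ENNReal.toReal_ofReal (by norm_num)]
    · rw [Real.norm_of_nonneg (hu0 x)]
      refine (norm_curl_sq_smul_gradient_le hf hψ x).trans ?_
      rw [abs_of_nonneg (hψ0 x)]
      have := mul_le_mul_of_nonneg_left (hψ1 x) (hu0 x)
      simp only [hu_def] at this ⊢
      linarith
  have hmain := h.abs_integral_mollify_mul_divergence_le hΩ φ hξΩ (hξs.trans hψs)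
  rw [integral_mul_divergence hf hξΩ.contDiff hξΩ.hasCompactSupport, abs_neg, ← hX,
    abs_of_nonneg (sq_nonneg _)] at hmain
  set X := (eLpNorm u 2 volume).toReal with hX_def
  have hX0 : 0 ≤ X := ENNReal.toReal_nonneg
  have hXle : X ≤ R * ‖w‖ + 2 * √ν * ‖θ‖ := by
    rcases hX0.eq_or_lt with h0 | h0
    · rw [← h0]; positivity
    refine le_of_mul_le_mul_right ?_ h0
    have h1 := mul_le_mul_of_nonneg_left hξn (norm_nonneg w)
    have h2 := mul_le_mul_of_nonneg_left hcn (mul_nonneg (Real.sqrt_nonneg ν) (norm_nonneg θ))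
    nlinarith
  refine (eLpNorm_mono_real (g := u) fun x => ?_).trans ?_
  · rw [norm_mul, norm_norm, Real.norm_of_nonneg (le_max_right _ _)]
    exact mul_le_mul_of_nonneg_right (hψb x).1 (norm_nonneg _)
  · rw [← ENNReal.ofReal_toReal hu.eLpNorm_ne_top]
    exact ENNReal.ofReal_le_ofReal hXle

/-! ### Mean square estimates -/

theorem eLpNorm_two_sq {α E : Type*} [MeasurableSpace α] [NormedAddCommGroup E] (f : α → E)
    (μ : Measure α) : eLpNorm f 2 μ ^ 2 = ∫⁻ x, ‖f x‖ₑ ^ 2 ∂μ := by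
  have := eLpNorm_nnreal_pow_eq_lintegral (μ := μ) (f := f) (p := 2) two_ne_zero
  norm_num at this
  exact_mod_cast this

theorem eLpNorm_two_le_iff {α E : Type*} [MeasurableSpace α] [NormedAddCommGroup E] {f : α → E}
    {μ : Measure α} {c : ℝ≥0∞} : eLpNorm f 2 μ ≤ c ↔ ∫⁻ x, ‖f x‖ₑ ^ 2 ∂μ ≤ c ^ 2 := by
  rw [← eLpNorm_two_sq]
  exact (ENNReal.pow_le_pow_left_iff two_ne_zero).symm

theorem sq_lintegral_le {α : Type*} [MeasurableSpace α] {μ : Measure α} [IsProbabilityMeasure μ]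
    {h : α → ℝ≥0∞} (hh : AEMeasurable h μ) : (∫⁻ x, h x ∂μ) ^ 2 ≤ ∫⁻ x, h x ^ 2 ∂μ := by
  have := ENNReal.lintegral_mul_le_Lp_mul_Lq μ Real.HolderConjugate.two_two hh
    (aemeasurable_const (b := (1 : ℝ≥0∞)))
  simp only [Pi.mul_apply, mul_one, ENNReal.one_rpow, lintegral_const, measure_univ] at this
  refine (pow_le_pow_left₀ zero_le this 2).trans (le_of_eq ?_)
  rw [← ENNReal.rpow_natCast, ← ENNReal.rpow_mul]
  norm_num

/-- Mollification does not increase the `L²` norm, in a local form. -/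
theorem eLpNorm_mollify_sub_const_le (φ : ContDiffBump (0 : R3)) {q : R3 → ℝ}
    (hqm : StronglyMeasurable q) (hq : LocallyIntegrable q) (c : ℝ) {K U : Set R3}
    (hK : MeasurableSet K) (hU : MeasurableSet U) (hKU : Metric.thickening φ.rOut K ⊆ U) :
    eLpNorm (fun x => mollify φ q x - c) 2 (volume.restrict K) ≤
      eLpNorm (fun x => q x - c) 2 (volume.restrict U) := by
  set ρ : R3 → ℝ≥0∞ := fun t => ENNReal.ofReal (φ.normed volume t) with hρ
  have hρm : Measurable ρ := (φ.continuous_normed (μ := volume)).measurable.ennreal_ofReal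
  have hprob : IsProbabilityMeasure (volume.withDensity ρ) := by
    refine ⟨?_⟩
    rw [withDensity_apply _ MeasurableSet.univ, Measure.restrict_univ,
      ← ofReal_integral_eq_lintegral_ofReal φ.integrable_normed
        (Filter.Eventually.of_forall φ.nonneg_normed), φ.integral_normed, ENNReal.ofReal_one]
  have hm : Measurable fun p : R3 × R3 => ‖q (p.1 - p.2) - c‖ₑ :=
    ((hqm.measurable.comp (measurable_fst.sub measurable_snd)).sub_const c).enorm
  have hm1 : ∀ x, Measurable fun t => ‖q (x - t) - c‖ₑ := fun x =>
    hm.comp (measurable_const.prodMk measurable_id)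
  have hpt : ∀ x, ‖mollify φ q x - c‖ₑ ^ 2 ≤
      ∫⁻ t, ‖q (x - t) - c‖ₑ ^ 2 ∂(volume.withDensity ρ) := fun x => by
    have hi : Integrable fun t => φ.normed volume t * q (x - t) :=
      φ.hasCompactSupport_normed.convolutionExists_left (ContinuousLinearMap.lsmul ℝ ℝ)
        φ.continuous_normed hq x
    have e : mollify φ q x - c = ∫ t, φ.normed volume t * (q (x - t) - c) := by
      simp_rw [mul_sub]
      rw [integral_sub hi (φ.integrable_normed.mul_const c), integral_mul_const,
        φ.integral_normed, one_mul, mollify_apply]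
    refine le_trans (pow_le_pow_left₀ zero_le ?_ 2) (sq_lintegral_le (hm1 x).aemeasurable)
    rw [e, lintegral_withDensity_eq_lintegral_mul _ hρm (hm1 x)]
    refine (enorm_integral_le_lintegral_enorm _).trans (le_of_eq ?_)
    refine lintegral_congr fun t => ?_
    rw [enorm_mul, Real.enorm_of_nonneg (φ.nonneg_normed t), Pi.mul_apply]
  rw [eLpNorm_two_le_iff, eLpNorm_two_sq]
  calc ∫⁻ x in K, ‖mollify φ q x - c‖ₑ ^ 2
      ≤ ∫⁻ x in K, ∫⁻ t, ‖q (x - t) - c‖ₑ ^ 2 ∂(volume.withDensity ρ) :=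
        lintegral_mono fun x => hpt x
    _ = ∫⁻ t, (∫⁻ x in K, ‖q (x - t) - c‖ₑ ^ 2) ∂(volume.withDensity ρ) :=
        lintegral_lintegral_swap (hm.pow_const 2).aemeasurable
    _ ≤ ∫⁻ _, (∫⁻ x in U, ‖q x - c‖ₑ ^ 2) ∂(volume.withDensity ρ) := by
        rw [lintegral_withDensity_eq_lintegral_mul _ hρm
          (hm.pow_const 2).lintegral_prod_left', lintegral_withDensity_eq_lintegral_mul _ hρm
          measurable_const]
        refine lintegral_mono fun t => ?_
        simp only [Pi.mul_apply]
        by_cases ht : φ.normed volume t = 0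
        · simp [hρ, ht]
        have ht' : ‖t‖ < φ.rOut := by
          have : t ∈ Function.support (φ.normed volume) := ht
          rwa [φ.support_normed_eq, mem_ball_zero_iff] at this
        refine mul_le_mul_right ?_ _
        rw [← lintegral_indicator hK, ← lintegral_indicator hU,
          ← lintegral_sub_right_eq_self (U.indicator fun x => ‖q x - c‖ₑ ^ 2) t]
        refine lintegral_mono fun x => ?_
        by_cases hx : x ∈ K
        · have : x - t ∈ U := hKU (Metric.mem_thickening_iff.2 ⟨x, hx, by
            rw [dist_eq_norm]; simpa using ht'⟩)
          simp [hx, this]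
        · simp [hx]
    _ = ∫⁻ x in U, ‖q x - c‖ₑ ^ 2 := by
        rw [lintegral_const, measure_univ, mul_one]

theorem enorm_increment_le {f : R3 → ℝ} (hf : ContDiff ℝ ∞ f) (v x : R3) :
    ‖f (x + v) - f x‖ₑ ≤ ‖v‖ₑ * ∫⁻ t in Ioc (0 : ℝ) 1, ‖fderiv ℝ f (x + t • v)‖ₑ := by
  have hfd : Continuous (fderiv ℝ f) := hf.continuous_fderiv (by simp)
  have hline : Continuous fun t : ℝ => x + t • v := by fun_prop
  have hd : ∀ t : ℝ, HasDerivAt (fun t : ℝ => f (x + t • v)) (fderiv ℝ f (x + t • v) v) t := by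
    intro t
    have h1 : HasDerivAt (fun t : ℝ => x + t • v) v t := by
      simpa using ((hasDerivAt_id t).smul_const v).const_add x
    exact ((hf.differentiable (by simp) _).hasFDerivAt).comp_hasDerivAt t h1
  have hc : Continuous fun t : ℝ => fderiv ℝ f (x + t • v) v :=
    (hfd.comp hline).clm_apply continuous_const
  have e : f (x + v) - f x = ∫ t in Ioc (0 : ℝ) 1, fderiv ℝ f (x + t • v) v := by
    rw [← intervalIntegral.integral_of_le zero_le_one,
      intervalIntegral.integral_eq_sub_of_hasDerivAt (fun t _ => hd t)
        (hc.intervalIntegrable _ _), one_smul, zero_smul, add_zero]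
  have hm : Measurable fun t : ℝ => ‖fderiv ℝ f (x + t • v)‖ₑ :=
    (hfd.comp hline).enorm.measurable
  rw [e, ← lintegral_const_mul _ hm]
  refine (enorm_integral_le_lintegral_enorm _).trans (lintegral_mono fun t => ?_)
  rw [mul_comm]
  exact ContinuousLinearMap.le_opENorm _ _

/-- The mean square of the increments of a smooth function in direction `v`. -/
theorem lintegral_increment_sq_le {f : R3 → ℝ} (hf : ContDiff ℝ ∞ f) (v : R3) {A B : Set R3}
    (hA : MeasurableSet A) (hB : MeasurableSet B)
    (hAB : ∀ x ∈ A, ∀ t ∈ Icc (0 : ℝ) 1, x + t • v ∈ B) :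
    ∫⁻ x in A, ‖f (x + v) - f x‖ₑ ^ 2 ≤ ‖v‖ₑ ^ 2 * ∫⁻ x in B, ‖fderiv ℝ f x‖ₑ ^ 2 := by
  have hfd : Continuous (fderiv ℝ f) := hf.continuous_fderiv (by simp)
  have hprob : IsProbabilityMeasure (volume.restrict (Ioc (0 : ℝ) 1)) := ⟨by simp⟩
  have hm : Measurable fun p : R3 × ℝ => ‖fderiv ℝ f (p.1 + p.2 • v)‖ₑ :=
    (hfd.comp (by fun_prop : Continuous fun p : R3 × ℝ => p.1 + p.2 • v)).enorm.measurable
  have hpt : ∀ x, ‖f (x + v) - f x‖ₑ ^ 2 ≤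
      ‖v‖ₑ ^ 2 * ∫⁻ t in Ioc (0 : ℝ) 1, ‖fderiv ℝ f (x + t • v)‖ₑ ^ 2 := fun x => by
    refine (pow_le_pow_left₀ zero_le (enorm_increment_le hf v x) 2).trans ?_
    rw [mul_pow]
    refine mul_le_mul_right (sq_lintegral_le ?_) _
    exact (hm.comp (measurable_const.prodMk measurable_id)).aemeasurable
  calc ∫⁻ x in A, ‖f (x + v) - f x‖ₑ ^ 2
      ≤ ∫⁻ x in A, ‖v‖ₑ ^ 2 * ∫⁻ t in Ioc (0 : ℝ) 1, ‖fderiv ℝ f (x + t • v)‖ₑ ^ 2 :=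
        lintegral_mono fun x => hpt x
    _ = ‖v‖ₑ ^ 2 * ∫⁻ t in Ioc (0 : ℝ) 1, ∫⁻ x in A, ‖fderiv ℝ f (x + t • v)‖ₑ ^ 2 := by
        rw [lintegral_const_mul _ (hm.pow_const 2).lintegral_prod_right']
        congr 1
        exact lintegral_lintegral_swap (hm.pow_const 2).aemeasurable
    _ ≤ ‖v‖ₑ ^ 2 * ∫⁻ t in Ioc (0 : ℝ) 1, ∫⁻ x in B, ‖fderiv ℝ f x‖ₑ ^ 2 := by
        gcongr ‖v‖ₑ ^ 2 * ?_
        refine setLIntegral_mono' measurableSet_Ioc fun t ht => ?_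
        rw [← lintegral_indicator hA, ← lintegral_indicator hB,
          ← lintegral_add_right_eq_self (B.indicator fun x => ‖fderiv ℝ f x‖ₑ ^ 2) (t • v)]
        refine lintegral_mono fun x => ?_
        by_cases hx : x ∈ A
        · simp [hx, hAB x hx t (Ioc_subset_Icc_self ht)]
        · simp [hx]
    _ = _ := by rw [lintegral_const, measure_univ, mul_one]

/-- If all increments of `q` by vectors of length less than `2r` have mean square at most `D²`
over a ball of radius `r`, then `q` is close in mean square to one of its values. -/
theorem exists_eLpNorm_sub_const_le_of_increments (x₀ : R3) {r : ℝ} (hr : 0 < r) :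
    ∃ C : ℝ≥0∞, C ≠ ⊤ ∧ ∀ q : R3 → ℝ, StronglyMeasurable q → ∀ D : ℝ≥0∞,
      (∀ v ∈ Metric.ball (0 : R3) (2 * r),
        eLpNorm (fun x => q (x + v) - q x) 2 (volume.restrict (Metric.ball x₀ r)) ≤ D) →
      ∃ c : ℝ, eLpNorm (fun x => q x - c) 2 (volume.restrict (Metric.ball x₀ r)) ≤ C * D := by
  set B := Metric.ball x₀ r with hB
  have hB0 : volume B ≠ 0 := (Metric.measure_ball_pos volume x₀ hr).ne'
  have hBt : volume B ≠ ⊤ := measure_ball_lt_top.ne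
  set k := volume (Metric.ball (0 : R3) (2 * r)) / volume B with hk
  have hkt : k ≠ ⊤ := ENNReal.div_ne_top measure_ball_lt_top.ne hB0
  refine ⟨1 + k, ENNReal.add_ne_top.2 ⟨ENNReal.one_ne_top, hkt⟩, fun q hq D hD => ?_⟩
  have hm : Measurable fun p : R3 × R3 => ‖q p.1 - q p.2‖ₑ ^ 2 :=
    (((hq.measurable.comp measurable_fst).sub (hq.measurable.comp measurable_snd)).enorm).pow_const
      2
  have hm' : Measurable fun p : R3 × R3 => ‖q (p.1 + p.2) - q p.1‖ₑ ^ 2 :=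
    (((hq.measurable.comp (measurable_fst.add measurable_snd)).sub
      (hq.measurable.comp measurable_fst)).enorm).pow_const 2
  -- choose `y` so that the integral over `x` is at most its mean over `y`
  obtain ⟨y, -, hy⟩ := exists_le_setLAverage hB0 hBt
    (f := fun y => ∫⁻ x in B, ‖q x - q y‖ₑ ^ 2)
    (hm.lintegral_prod_left').aemeasurable
  refine ⟨q y, eLpNorm_two_le_iff.2 (hy.trans ?_)⟩
  rw [setLAverage_eq]
  have hdouble : ∫⁻ y in B, ∫⁻ x in B, ‖q x - q y‖ₑ ^ 2 ≤
      volume (Metric.ball (0 : R3) (2 * r)) * D ^ 2 := by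
    calc ∫⁻ y in B, ∫⁻ x in B, ‖q x - q y‖ₑ ^ 2
        = ∫⁻ x in B, ∫⁻ y in B, ‖q x - q y‖ₑ ^ 2 :=
          (lintegral_lintegral_swap hm.aemeasurable).symm
      _ ≤ ∫⁻ x in B, ∫⁻ v in Metric.ball (0 : R3) (2 * r), ‖q (x + v) - q x‖ₑ ^ 2 := by
          refine setLIntegral_mono' measurableSet_ball fun x hx => ?_
          rw [← lintegral_indicator measurableSet_ball, ← lintegral_indicator measurableSet_ball,
            ← lintegral_add_left_eq_self (B.indicator fun y => ‖q x - q y‖ₑ ^ 2) x]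
          refine lintegral_mono fun v => ?_
          by_cases hv : x + v ∈ B
          · have : v ∈ Metric.ball (0 : R3) (2 * r) := by
              rw [mem_ball_zero_iff]
              have h1 := dist_triangle_right (x + v) x x₀
              rw [dist_eq_norm, add_sub_cancel_left] at h1
              linarith [Metric.mem_ball.1 hv, Metric.mem_ball.1 hx]
            simp only [indicator_of_mem hv, indicator_of_mem this, ← neg_sub (q (x + v)) (q x),
              enorm_neg, le_refl]
          · simp [hv]
      _ = ∫⁻ v in Metric.ball (0 : R3) (2 * r), ∫⁻ x in B, ‖q (x + v) - q x‖ₑ ^ 2 :=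
          lintegral_lintegral_swap hm'.aemeasurable
      _ ≤ ∫⁻ v in Metric.ball (0 : R3) (2 * r), D ^ 2 :=
          setLIntegral_mono' measurableSet_ball fun v hv => eLpNorm_two_le_iff.1 (hD v hv)
      _ = _ := by rw [lintegral_const, Measure.restrict_apply_univ, mul_comm]
  calc (∫⁻ y in B, ∫⁻ x in B, ‖q x - q y‖ₑ ^ 2) / volume B
      ≤ volume (Metric.ball (0 : R3) (2 * r)) * D ^ 2 / volume B := by gcongr
    _ = k * D ^ 2 := by rw [hk, ENNReal.mul_div_right_comm]
    _ ≤ ((1 + k) * D) ^ 2 := by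
        rw [mul_pow]
        gcongr
        rw [sq]
        calc k ≤ 1 + k := le_add_self
          _ = (1 + k) * 1 := (mul_one _).symm
          _ ≤ (1 + k) * (1 + k) := by gcongr; exact le_self_add

/-! ### Domains with an improved Poincaré inequality -/

/-- On `U`, every `q ∈ L²` is bounded, up to a constant, by the norm of its gradient weighted with
the distance to the complement of `Ω`. -/
def PoincareOn (Ω U : Set R3) : Prop :=
  ∃ C : ℝ≥0∞, C ≠ ⊤ ∧ ∀ (q : R3 → ℝ) (M : NNReal), StronglyMeasurable q → MemLp q 2 volume →
    WeightedGradBound Ω q M →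
    ∃ c : ℝ, eLpNorm (fun x => q x - c) 2 (volume.restrict U) ≤ C * M

theorem PoincareOn.mono {Ω U V : Set R3} (h : PoincareOn Ω U) (hVU : V ⊆ U) : PoincareOn Ω V := by
  obtain ⟨C, hC, h⟩ := h
  refine ⟨C, hC, fun q M hqm hq hM => ?_⟩
  obtain ⟨c, hc⟩ := h q M hqm hq hM
  exact ⟨c, (eLpNorm_mono_measure _ (Measure.restrict_mono hVU le_rfl)).trans hc⟩

theorem eLpNorm_restrict_union_le {f : R3 → ℝ} (U V : Set R3) :
    eLpNorm f 2 (volume.restrict (U ∪ V)) ≤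
      eLpNorm f 2 (volume.restrict U) + eLpNorm f 2 (volume.restrict V) := by
  rw [eLpNorm_two_le_iff, add_sq, eLpNorm_two_sq, eLpNorm_two_sq]
  refine (lintegral_union_le _ _ _).trans ?_
  rw [add_right_comm]
  exact le_self_add

/-- Two sets with an improved Poincaré inequality can be glued along an overlap of positive
measure, because the two constants must be close to each other there. -/
theorem PoincareOn.union {Ω U V : Set R3} (hU : PoincareOn Ω U) (hV : PoincareOn Ω V)
    (h0 : volume (U ∩ V) ≠ 0) (hVt : volume V ≠ ⊤) : PoincareOn Ω (U ∪ V) := by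
  obtain ⟨C₁, hC₁, h₁⟩ := hU
  obtain ⟨C₂, hC₂, h₂⟩ := hV
  have hUVt : volume (U ∩ V) ≠ ⊤ := measure_ne_top_of_subset inter_subset_right hVt
  set m := volume (U ∩ V) ^ (1 / 2 : ℝ) with hm
  set s := volume V ^ (1 / 2 : ℝ) with hs
  have hm0 : m ≠ 0 := by
    rw [hm, Ne, ENNReal.rpow_eq_zero_iff]
    simp [h0, hUVt]
  have hmt : m ≠ ⊤ := ENNReal.rpow_ne_top_of_nonneg (by norm_num) hUVt
  have hst : s ≠ ⊤ := ENNReal.rpow_ne_top_of_nonneg (by norm_num) hVt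
  refine ⟨C₁ + (C₂ + (C₁ + C₂) / m * s), by finiteness, fun q M hqm hq hM => ?_⟩
  obtain ⟨c₁, hc₁⟩ := h₁ q M hqm hq hM
  obtain ⟨c₂, hc₂⟩ := h₂ q M hqm hq hM
  have hmeas : ∀ (c : ℝ) (S : Set R3),
      AEStronglyMeasurable (fun x => q x - c) (volume.restrict S) := fun c S =>
    (hqm.sub stronglyMeasurable_const).aestronglyMeasurable
  have hconst : ∀ S : Set R3, eLpNorm (fun _ : R3 => c₂ - c₁) 2 (volume.restrict S) =
      ‖c₂ - c₁‖ₑ * volume S ^ (1 / 2 : ℝ) := fun S => by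
    rw [eLpNorm_const' _ two_ne_zero ENNReal.ofNat_ne_top, Measure.restrict_apply_univ]
    simp
  have hdiff : ‖c₂ - c₁‖ₑ ≤ (C₁ + C₂) / m * M := by
    have h3 : ‖c₂ - c₁‖ₑ * m ≤ (C₁ + C₂) * M := by
      rw [hm, ← hconst]
      have e : (fun _ : R3 => c₂ - c₁) = (fun x => q x - c₁) - fun x => q x - c₂ := by
        ext x; simp
      rw [e, add_mul]
      refine (eLpNorm_sub_le (hmeas _ _) (hmeas _ _) (by norm_num)).trans (add_le_add ?_ ?_)
      · exact (eLpNorm_mono_measure _ (Measure.restrict_mono inter_subset_left le_rfl)).trans hc₁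
      · exact (eLpNorm_mono_measure _ (Measure.restrict_mono inter_subset_right le_rfl)).trans hc₂
    rw [← ENNReal.mul_div_right_comm]
    exact (ENNReal.le_div_iff_mul_le (Or.inl hm0) (Or.inl hmt)).2 h3
  refine ⟨c₁, (eLpNorm_restrict_union_le U V).trans ?_⟩
  rw [add_mul]
  refine add_le_add hc₁ ?_
  have e : (fun x => q x - c₁) = (fun x => q x - c₂) + fun _ => c₂ - c₁ := by
    ext x; simp
  rw [e, add_mul]
  refine (eLpNorm_add_le (hmeas _ _) aestronglyMeasurable_const (by norm_num)).trans
    (add_le_add hc₂ ?_)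
  rw [hconst, ← hs, mul_right_comm]
  gcongr

/-- Bump functions around `0` of radius `1 / (n + 1)`. -/
noncomputable def bumpSeq (n : ℕ) : ContDiffBump (0 : R3) :=
  ⟨1 / (n + 1) / 2, 1 / (n + 1), by positivity, half_lt_self (by positivity)⟩

theorem tendsto_bumpSeq_rOut : Filter.Tendsto (fun n => (bumpSeq n).rOut) Filter.atTop (nhds 0) :=
  tendsto_one_div_add_atTop_nhds_zero_nat

theorem ae_tendsto_mollify_bumpSeq {q : R3 → ℝ} (hq : LocallyIntegrable q) :
    ∀ᵐ x, Filter.Tendsto (fun n => mollify (bumpSeq n) q x) Filter.atTop (nhds (q x)) :=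
  ContDiffBump.ae_convolution_tendsto_right_of_locallyIntegrable (K := 2) tendsto_bumpSeq_rOut
    (Filter.Eventually.of_forall fun n => le_of_eq (by simp only [bumpSeq]; ring)) hq

theorem eLpNorm_le_of_tendsto {μ : Measure R3} {F : ℕ → R3 → ℝ} {G : R3 → ℝ} {D : ℝ≥0∞}
    (hF : ∀ n, AEStronglyMeasurable (F n) μ)
    (hlim : ∀ᵐ x ∂μ, Filter.Tendsto (fun n => F n x) Filter.atTop (nhds (G x)))
    (hD : ∀ᶠ n in Filter.atTop, eLpNorm (F n) 2 μ ≤ D) : eLpNorm G 2 μ ≤ D := by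
  refine (Lp.eLpNorm_lim_le_liminf_eLpNorm hF G hlim).trans ?_
  refine (Filter.liminf_le_liminf hD).trans ?_
  simp

/-- Every point of an open set is the centre of a ball with a Poincaré inequality. -/
theorem exists_poincareOn_ball {Ω : Set R3} (ho : IsOpen Ω) (hne : Ωᶜ.Nonempty) {x₀ : R3}
    (hx₀ : x₀ ∈ Ω) : ∃ r > 0, Metric.ball x₀ r ⊆ Ω ∧ PoincareOn Ω (Metric.ball x₀ r) := by
  obtain ⟨r', hr', hball⟩ := Metric.isOpen_iff.1 ho x₀ hx₀
  set r := r' / 4 with hr_def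
  have hr : 0 < r := by positivity
  refine ⟨r, hr, (Metric.ball_subset_ball (by linarith)).trans hball, ?_⟩
  have hdist : ∀ x ∈ Metric.ball x₀ (3 * r), r ≤ Metric.infDist x Ωᶜ := fun x hx => by
    refine (Metric.le_infDist hne).2 fun y hy => ?_
    by_contra! hlt
    refine hy (hball (Metric.mem_ball.2 ?_))
    have := dist_triangle_left y x₀ x
    linarith [Metric.mem_ball.1 hx]
  obtain ⟨C, hC, hCq⟩ := exists_eLpNorm_sub_const_le_of_increments x₀ hr
  refine ⟨C * 4, by finiteness, fun q M hqm hq hM => ?_⟩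
  have hql : LocallyIntegrable q := hq.locallyIntegrable (by norm_num)
  rw [mul_assoc]
  refine hCq q hqm _ fun v hv => ?_
  have hv' := mem_ball_zero_iff.1 hv
  have hlim := ae_tendsto_mollify_bumpSeq hql
  have hlimv : ∀ᵐ x, Filter.Tendsto (fun n => mollify (bumpSeq n) q (x + v)) Filter.atTop
      (nhds (q (x + v))) :=
    (measurePreserving_add_right volume v).quasiMeasurePreserving.ae hlim
  have hcont : ∀ n, Continuous (mollify (bumpSeq n) q) := fun n =>
    (contDiff_mollify (bumpSeq n) hql).continuous
  refine eLpNorm_le_of_tendsto (F := fun n x => mollify (bumpSeq n) q (x + v) -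
      mollify (bumpSeq n) q x) (fun n => ?_) (ae_restrict_of_ae ?_) ?_
  · exact (((hcont n).comp (continuous_add_const v)).sub (hcont n)).aestronglyMeasurable
  · filter_upwards [hlim, hlimv] with x h1 h2
    exact h2.sub h1
  · have hev : ∀ᶠ n in Filter.atTop, (bumpSeq n).rOut < r / 8 :=
      tendsto_bumpSeq_rOut.eventually_lt_const (by positivity)
    filter_upwards [hev] with n hn
    set f := mollify (bumpSeq n) q with hf
    have h1 := lintegral_increment_sq_le (contDiff_mollify (bumpSeq n) hql) v
      (A := Metric.ball x₀ r) (B := Metric.ball x₀ (3 * r)) measurableSet_ball measurableSet_ball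
      fun x hx t ht => by
        have hx' := Metric.mem_ball.1 hx
        have h2 := dist_triangle (x + t • v) x x₀
        rw [dist_eq_norm (x + t • v) x, add_sub_cancel_left, norm_smul, Real.norm_of_nonneg ht.1] at h2
        have h3 := mul_le_of_le_one_left (norm_nonneg v) ht.2
        exact Metric.mem_ball.2 (by linarith)
    refine eLpNorm_two_le_iff.2 (h1.trans ?_)
    have h2 : ∫⁻ x in Metric.ball x₀ (3 * r), ‖fderiv ℝ f x‖ₑ ^ 2 ≤
        (ENNReal.ofReal (2 / r) * M) ^ 2 := by
      rw [← eLpNorm_two_le_iff]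
      have h3 : eLpNorm (fderiv ℝ f) 2 (volume.restrict (Metric.ball x₀ (3 * r))) ≤
          ENNReal.ofReal (2 / r) * eLpNorm (fun x => max (Metric.infDist x Ωᶜ -
            4 * (bumpSeq n).rOut) 0 * ‖fderiv ℝ f x‖) 2
            (volume.restrict (Metric.ball x₀ (3 * r))) := by
        refine eLpNorm_le_mul_eLpNorm_of_ae_le_mul ?_ 2
        filter_upwards [ae_restrict_mem measurableSet_ball] with x hx
        have h4 : r / 2 ≤ max (Metric.infDist x Ωᶜ - 4 * (bumpSeq n).rOut) 0 :=
          le_max_of_le_left (by linarith [hdist x hx])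
        rw [norm_mul, norm_norm, Real.norm_of_nonneg (le_max_right _ _), ← mul_assoc]
        refine le_mul_of_one_le_left (norm_nonneg _) ?_
        calc (1 : ℝ) = 2 / r * (r / 2) := by field_simp
          _ ≤ _ := by gcongr
      refine h3.trans ?_
      gcongr
      exact (eLpNorm_mono_measure _ Measure.restrict_le_self).trans (hM (bumpSeq n))
    calc ‖v‖ₑ ^ 2 * ∫⁻ x in Metric.ball x₀ (3 * r), ‖fderiv ℝ f x‖ₑ ^ 2
        ≤ ENNReal.ofReal (2 * r) ^ 2 * (ENNReal.ofReal (2 / r) * M) ^ 2 := by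
          gcongr
          rw [← ofReal_norm]
          exact ENNReal.ofReal_le_ofReal hv'.le
      _ = (4 * (M : ℝ≥0∞)) ^ 2 := by
          rw [← mul_pow, ← mul_assoc, ← ENNReal.ofReal_mul (by positivity)]
          congr 3
          rw [show 2 * r * (2 / r) = 4 by field_simp; norm_num]
          simp

/-! ### A Hardy inequality -/

/-- At `a = 0` the function is not differentiable, and `deriv` takes its default value `0`. -/
theorem deriv_max_add_zero (a : ℝ) :
    deriv (fun t : ℝ => max (a + t) 0) 0 = if 0 < a then 1 else 0 := by
  rcases lt_trichotomy a 0 with h | h | h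
  · have : (fun t : ℝ => max (a + t) 0) =ᶠ[nhds 0] fun _ => 0 := by
      filter_upwards [gt_mem_nhds (neg_pos.2 h)] with t ht
      exact max_eq_right (by linarith)
    rw [this.deriv_eq, deriv_const, if_neg h.not_gt]
  · subst h
    rw [if_neg (lt_irrefl _)]
    refine deriv_zero_of_not_differentiableAt fun hd => not_differentiableAt_abs_zero ?_
    have : (abs : ℝ → ℝ) = fun t => 2 * max (0 + t) 0 - t := by
      ext t
      rcases le_total 0 t with ht | ht
      · rw [abs_of_nonneg ht, zero_add, max_eq_left ht]; ring
      · rw [abs_of_nonpos ht, zero_add, max_eq_right ht]; ring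
    rw [this]
    exact (hd.const_mul 2).sub differentiableAt_id
  · have : (fun t : ℝ => max (a + t) 0) =ᶠ[nhds 0] fun t => a + t := by
      filter_upwards [lt_mem_nhds (neg_lt_zero.2 h)] with t ht
      exact max_eq_left (by linarith)
    rw [this.deriv_eq, if_pos h]
    simp

/-- Hardy's inequality in the region above a Lipschitz graph, `τ` being the height above the graph
and `v` the vertical direction: it follows from `∫ F² = -2 ∫ τ F ∂ᵥF`, as `∂ᵥτ = 1`. -/
theorem eLpNorm_le_two_mul_eLpNorm_height_mul {τ : R3 → ℝ} {L : NNReal} (hτ : LipschitzWith L τ)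
    {v : R3} (hv : ∀ x t, τ (x + t • v) = τ x + t) {F : R3 → ℝ} (hF : ContDiff ℝ ∞ F)
    (hFc : HasCompactSupport F) :
    eLpNorm F 2 (volume.restrict {x | 0 < τ x}) ≤
      2 * eLpNorm (fun x => max (τ x) 0 * fderiv ℝ F x v) 2 volume := by
  set P : Set R3 := {x | 0 < τ x} with hP
  have hPm : MeasurableSet P := measurableSet_lt measurable_const hτ.continuous.measurable
  have hFd : Continuous (fderiv ℝ F) := hF.continuous_fderiv (by simp)
  have hτ' : LipschitzWith L fun x => max (τ x) 0 := hτ.max_const 0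
  have hFm : MemLp F 2 volume := hF.continuous.memLp_of_hasCompactSupport hFc
  have ha : MemLp (P.indicator F) 2 volume := hFm.indicator hPm
  set b : R3 → ℝ := fun x => max (τ x) 0 * fderiv ℝ F x v with hb_def
  have hb : MemLp b 2 volume :=
    (hτ'.continuous.mul (hFd.clm_apply continuous_const)).memLp_of_hasCompactSupport
      (hFc.fderiv_apply ℝ v).mul_left
  have hsq : ContDiff ℝ ∞ fun x => F x ^ 2 := hF.pow 2
  have hsqc : HasCompactSupport fun x => F x ^ 2 := hFc.comp_left (g := fun t : ℝ => t ^ 2) (by simp)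
  obtain ⟨D, hD⟩ := ContDiff.lipschitzWith_of_hasCompactSupport hsqc hsq (by simp)
  have hibp := LipschitzWith.integral_lineDeriv_mul_eq (μ := volume) hτ' hD hsqc v
  have hl : ∀ x, lineDeriv ℝ (fun x => max (τ x) 0) x v * F x ^ 2 =
      inner ℝ (P.indicator F x) (P.indicator F x) := fun x => by
    rw [lineDeriv]
    simp_rw [hv]
    rw [deriv_max_add_zero]
    by_cases hx : x ∈ P
    · rw [if_pos (show 0 < τ x from hx), indicator_of_mem hx, real_inner_self_eq_norm_sq, Real.norm_eq_abs, sq_abs,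
        one_mul]
    · rw [if_neg (show ¬0 < τ x from hx), indicator_of_notMem hx, inner_zero_left, zero_mul]
  have hr : ∀ x, lineDeriv ℝ (fun x => F x ^ 2) x (-v) * max (τ x) 0 =
      -2 * inner ℝ (P.indicator F x) (b x) := fun x => by
    rw [(hsq.differentiable (by simp) x).lineDeriv_eq_fderiv,
      ((hF.differentiable (by simp) x).hasFDerivAt.pow 2).fderiv]
    by_cases hx : x ∈ P
    · rw [indicator_of_mem hx]
      simp [hb_def]
      ring
    · have : max (τ x) 0 = 0 := max_eq_right (not_lt.1 hx)
      simp [hx, this]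
  simp_rw [hl, hr] at hibp
  rw [integral_const_mul] at hibp
  have e1 : ∫ x, inner ℝ (P.indicator F x) (P.indicator F x) = ‖ha.toLp _‖ ^ 2 := by
    rw [← real_inner_self_eq_norm_sq, L2.inner_def]
    refine integral_congr_ae ?_
    filter_upwards [ha.coeFn_toLp] with x hx
    rw [hx]
  have e2 : ∫ x, inner ℝ (P.indicator F x) (b x) = inner ℝ (ha.toLp _) (hb.toLp _) := by
    rw [L2.inner_def]
    refine integral_congr_ae ?_
    filter_upwards [ha.coeFn_toLp, hb.coeFn_toLp] with x hx hx'
    rw [hx, hx']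
  rw [e1, e2] at hibp
  have hle : ‖ha.toLp _‖ ≤ 2 * ‖hb.toLp _‖ := by
    rcases (norm_nonneg (ha.toLp _)).eq_or_lt with h0 | h0
    · rw [← h0]; positivity
    refine le_of_mul_le_mul_right ?_ h0
    rw [← sq, hibp]
    have := (abs_le.1 (abs_real_inner_le_norm (ha.toLp _) (hb.toLp _))).1
    linarith
  rw [Lp.norm_toLp, Lp.norm_toLp] at hle
  rw [← eLpNorm_indicator_eq_eLpNorm_restrict hPm, ← ENNReal.ofReal_toReal ha.eLpNorm_ne_top,
    ← ENNReal.ofReal_toReal hb.eLpNorm_ne_top]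
  refine (ENNReal.ofReal_le_ofReal hle).trans (le_of_eq ?_)
  rw [ENNReal.ofReal_mul (by norm_num)]
  norm_num

/-! ### Poincaré inequalities near the boundary -/

/-- A patch of the boundary of `Ω` at `x₀`. Near `x₀`, the set `Ω` is where the height `τ` above a
Lipschitz graph is positive, `v` is the vertical direction, and the cutoff function `χ` is the
product of a horizontal and a vertical one. Hence the vertical derivative of `χ` vanishes near the
graph: at positive height it lives in a compact subset `T` of `Ω`. -/
structure BoundaryPatch (Ω : Set R3) (x₀ : R3) where
  /-- the height above the graph -/
  τ : R3 → ℝ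
  /-- the Lipschitz constant of the height -/
  L : NNReal
  /-- the vertical direction -/
  v : R3
  /-- the cutoff function -/
  χ : R3 → ℝ
  /-- the set containing the support of the vertical derivative of the cutoff function -/
  T : Set R3
  /-- the radius of a ball on which the cutoff function is one -/
  ρ : ℝ
  lipschitz : LipschitzWith L τ
  height_add : ∀ x t, τ (x + t • v) = τ x + t
  norm_v : ‖v‖ ≤ 1
  contDiff : ContDiff ℝ ∞ χ
  hasCompactSupport : HasCompactSupport χ
  nonneg : ∀ x, 0 ≤ χ x
  le_one : ∀ x, χ x ≤ 1
  ρ_pos : 0 < ρ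
  eq_one : ∀ x ∈ Metric.ball x₀ ρ, χ x = 1
  height_pos : ∀ x ∈ Metric.ball x₀ ρ, x ∈ Ω → 0 < τ x
  height_le : ∀ x, χ x ≠ 0 → τ x ≤ L * Metric.infDist x Ωᶜ
  isCompact : IsCompact T
  subset : T ⊆ Ω
  mem_of_deriv : ∀ x, 0 < τ x → fderiv ℝ χ x v ≠ 0 → x ∈ T

theorem nonempty_boundaryPatch {Ω : Set R3} (hne : Ωᶜ.Nonempty) (ho : IsOpen Ω)
    (hlip : HasLipschitzBoundary Ω) {x₀ : R3} (hx₀ : x₀ ∈ frontier Ω) :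
    Nonempty (BoundaryPatch Ω x₀) := by
  obtain ⟨e, K, g, r, hg, hr, hgraph⟩ := hlip x₀ hx₀
  set τ : R3 → ℝ := fun x => (e x).snd - g (e x).fst with hτ_def
  set L : NNReal := 1 + K with hL_def
  have hL1 : (1 : ℝ) ≤ L := by simp [hL_def]
  have hfst : ∀ x y, dist (e x).fst (e y).fst ≤ dist x y := fun x y => by
    rw [← e.dist_map x y, dist_eq_norm, dist_eq_norm]
    exact WithLp.norm_fst_le _ (e x - e y)
  have hsnd : ∀ x y, |(e x).snd - (e y).snd| ≤ dist x y := fun x y => by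
    rw [← e.dist_map x y, dist_eq_norm, ← Real.norm_eq_abs]
    exact WithLp.norm_snd_le _ (e x - e y)
  have hτL : ∀ x y, τ x - τ y ≤ L * dist x y := fun x y => by
    have h1 := (abs_le.1 (hsnd x y)).2
    have h2 := hg.dist_le_mul (e x).fst (e y).fst
    have h3 := mul_le_mul_of_nonneg_left (hfst x y) K.coe_nonneg
    rw [Real.dist_eq] at h2
    have h4 := (abs_le.1 h2).1
    simp only [hτ_def, hL_def, NNReal.coe_add, NNReal.coe_one]
    linarith
  have hτlip : LipschitzWith L τ := LipschitzWith.of_le_add_mul L fun x y => by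
    linarith [hτL x y]
  have hτ0 : τ x₀ = 0 := by
    have hx : x₀ ∉ Ω := by
      rw [ho.frontier_eq] at hx₀; exact hx₀.2
    refine le_antisymm ?_ ?_
    · by_contra! h
      exact hx ((hgraph x₀ (Metric.mem_ball_self hr)).2 (by simpa [hτ_def] using h))
    · by_contra! h
      have h1 : ∀ᶠ y in nhds x₀, τ y < 0 := hτlip.continuous.continuousAt.eventually_lt_const h
      obtain ⟨y, ⟨hy1, hy2⟩, hy3⟩ := mem_closure_iff_nhds.1 (frontier_subset_closure hx₀) _
        (Filter.inter_mem h1 (Metric.ball_mem_nhds x₀ hr))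
      have := (hgraph y hy2).1 hy3
      have hy1' : (e y).snd - g (e y).fst < 0 := hy1
      linarith
  have hgraph' : ∀ y ∈ Metric.ball x₀ r, y ∈ Ω ↔ 0 < τ y := fun y hy => by
    rw [hgraph y hy, hτ_def, sub_pos]
  -- the height is comparable with the distance to the complement
  have hdist : ∀ x ∈ Metric.ball x₀ (r / 2), τ x ≤ L * Metric.infDist x Ωᶜ := fun x hx => by
    have hx' := Metric.mem_ball.1 hx
    rw [← div_le_iff₀' (by linarith)]
    refine (Metric.le_infDist hne).2 fun y hy => ?_
    rw [div_le_iff₀' (by linarith)]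
    by_cases hyb : y ∈ Metric.ball x₀ r
    · have h1 : τ y ≤ 0 := not_lt.1 fun h => hy ((hgraph' y hyb).2 h)
      linarith [hτL x y]
    · have h1 : r ≤ dist y x₀ := not_lt.1 hyb
      have h2 := dist_triangle_left y x₀ x
      have h3 : dist x x₀ ≤ dist x y := by linarith
      have h4 := hτL x x₀
      have h5 := mul_le_mul_of_nonneg_left h3 L.coe_nonneg
      linarith
  -- the vertical direction
  set v : R3 := e.symm (WithLp.toLp 2 (0, 1)) with hv_def
  have hev : ∀ x (t : ℝ), e (x + t • v) = e x + t • WithLp.toLp 2 (0, 1) := fun x t => by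
    rw [map_add, map_smul, hv_def, e.apply_symm_apply]
  have hev1 : ∀ x (t : ℝ), (e (x + t • v)).fst = (e x).fst := fun x t => by
    rw [hev]; simp
  have hev2 : ∀ x (t : ℝ), (e (x + t • v)).snd = (e x).snd + t := fun x t => by
    rw [hev]; simp
  have hτv : ∀ x t, τ (x + t • v) = τ x + t := fun x t => by
    simp only [hτ_def, hev1, hev2]; ring
  have hvn : ‖v‖ ≤ 1 := by
    rw [hv_def, e.symm.norm_map]
    simp
  -- the cutoff function `χ`, a product of a horizontal and a vertical one
  set s : ℝ := r / 8 with hs_def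
  have hs : 0 < s := by positivity
  -- over a horizontal ball of radius `ρ` the graph varies by at most `s / 2`
  set ρ : ℝ := s / (2 * L) with hρ_def
  have hρ : 0 < ρ := by positivity
  have hρL : L * ρ = s / 2 := by
    rw [hρ_def]; field_simp
  have hρs : ρ ≤ s / 2 := by nlinarith
  have hKρ : K * ρ ≤ s / 2 := by
    rw [← hρL, hL_def, NNReal.coe_add, NNReal.coe_one]; nlinarith
  let χ₁ : ContDiffBump (e x₀).fst := ⟨ρ / 2, ρ, by positivity, half_lt_self hρ⟩
  let χ₂ : ContDiffBump (e x₀).snd := ⟨s, 2 * s, hs, by linarith⟩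
  set χ : R3 → ℝ := fun x => χ₁ (e x).fst * χ₂ (e x).snd with hχ_def
  have hχ : ContDiff ℝ ∞ χ := by
    have h1 : ContDiff ℝ ∞ fun x => (e x).fst :=
      ((WithLp.fstL 2 ℝ (EuclideanSpace ℝ (Fin 2)) ℝ).comp
        (e.toContinuousLinearEquiv : R3 →L[ℝ] _)).contDiff
    have h2 : ContDiff ℝ ∞ fun x => (e x).snd :=
      ((WithLp.sndL 2 ℝ (EuclideanSpace ℝ (Fin 2)) ℝ).comp
        (e.toContinuousLinearEquiv : R3 →L[ℝ] _)).contDiff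
    exact (χ₁.contDiff.comp h1).mul (χ₂.contDiff.comp h2)
  have hnear : ∀ x, dist (e x).fst (e x₀).fst ≤ ρ → |(e x).snd - (e x₀).snd| ≤ 2 * s →
      x ∈ Metric.closedBall x₀ (5 / 2 * s) := fun x h1 h2 => by
    rw [Metric.mem_closedBall, ← e.dist_map, WithLp.prod_dist_eq_of_L2]
    rw [Real.sqrt_le_left (by positivity)]
    have h1' := pow_le_pow_left₀ dist_nonneg (h1.trans hρs) 2
    have h2' := pow_le_pow_left₀ (abs_nonneg _) h2 2
    rw [Real.dist_eq]
    nlinarith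
  have hχsupp : ∀ x, χ x ≠ 0 → x ∈ Metric.closedBall x₀ (5 / 2 * s) := fun x hx => by
    refine hnear x ?_ ?_
    · by_contra! h
      exact hx (by rw [hχ_def]; simp only [χ₁.zero_of_le_dist h.le, zero_mul])
    · by_contra! h
      exact hx (by rw [hχ_def]; simp only [χ₂.zero_of_le_dist (x := (e x).snd) h.le, mul_zero])
  have hχc : HasCompactSupport χ :=
    HasCompactSupport.intro (isCompact_closedBall x₀ (5 / 2 * s)) fun x hx => by
      by_contra h
      exact hx (hχsupp x h)
  have hχ0 : ∀ x, 0 ≤ χ x := fun x => mul_nonneg χ₁.nonneg χ₂.nonneg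
  have hχ1 : ∀ x, χ x ≤ 1 := fun x => mul_le_one₀ χ₁.le_one χ₂.nonneg χ₂.le_one
  have hχone : ∀ x ∈ Metric.ball x₀ (ρ / 2), χ x = 1 := fun x hx => by
    have hx' := (Metric.mem_ball.1 hx).le
    simp only [hχ_def]
    rw [χ₁.one_of_mem_closedBall (Metric.mem_closedBall.2 ((hfst x x₀).trans hx')),
      χ₂.one_of_mem_closedBall (Metric.mem_closedBall.2 ?_), one_mul]
    rw [Real.dist_eq]
    exact (hsnd x x₀).trans (hx'.trans (by change ρ / 2 ≤ s; linarith))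
  -- At positive height, `∂ᵥχ ≠ 0` forces the vertical coordinate to exceed that of `x₀` by `s`,
  -- hence a height of at least `s / 2`.
  set T : Set R3 := Metric.closedBall x₀ (5 / 2 * s) ∩ {x | s / 2 ≤ τ x} with hT_def
  have hTc : IsCompact T := (isCompact_closedBall x₀ _).inter_right
    (isClosed_le continuous_const hτlip.continuous)
  have hTΩ : T ⊆ Ω := fun x hx =>
    (hgraph' x (Metric.closedBall_subset_ball (by rw [hs_def]; linarith) hx.1)).2
      ((half_pos hs).trans_le hx.2)
  have hχv : ∀ x, 0 < τ x → fderiv ℝ χ x v ≠ 0 → x ∈ T := fun x hx hne => by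
    have hder : fderiv ℝ χ x v =
        deriv (fun t : ℝ => χ₁ (e x).fst * χ₂ ((e x).snd + t)) 0 := by
      rw [← (hχ.differentiable (by simp) x).lineDeriv_eq_fderiv, lineDeriv]
      simp only [hχ_def, hev1, hev2]
    have h1 : dist (e x).fst (e x₀).fst ≤ ρ := by
      by_contra! h
      refine hne ?_
      rw [hder, χ₁.zero_of_le_dist h.le]
      simp
    have hcont : Filter.Tendsto (fun t : ℝ => (e x).snd + t) (nhds 0) (nhds (e x).snd) := by
      have : Continuous fun t : ℝ => (e x).snd + t := by fun_prop
      simpa using this.tendsto 0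
    have h2 : |(e x).snd - (e x₀).snd| ≤ 2 * s := by
      by_contra! h
      refine hne ?_
      have h3 : ∀ᶠ y in nhds (e x).snd, 2 * s < |y - (e x₀).snd| :=
        (by fun_prop : Continuous fun y : ℝ => |y - (e x₀).snd|).continuousAt.eventually_const_lt h
      have h4 : (fun t : ℝ => χ₁ (e x).fst * χ₂ ((e x).snd + t)) =ᶠ[nhds 0] fun _ => 0 := by
        filter_upwards [hcont.eventually h3] with t ht
        rw [χ₂.zero_of_le_dist (x := (e x).snd + t) ht.le, mul_zero]
      rw [hder, h4.deriv_eq, deriv_const]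
    have h3 : s ≤ |(e x).snd - (e x₀).snd| := by
      by_contra! h
      refine hne ?_
      have h3 : ∀ᶠ y in nhds (e x).snd, |y - (e x₀).snd| < s :=
        (by fun_prop : Continuous fun y : ℝ => |y - (e x₀).snd|).continuousAt.eventually_lt_const h
      have h4 : (fun t : ℝ => χ₁ (e x).fst * χ₂ ((e x).snd + t)) =ᶠ[nhds 0]
          fun _ => χ₁ (e x).fst := by
        filter_upwards [hcont.eventually h3] with t ht
        rw [χ₂.one_of_mem_closedBall (x := (e x).snd + t) ht.le, mul_one]
      rw [hder, h4.deriv_eq, deriv_const]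
    refine ⟨hnear x h1 h2, ?_⟩
    have h5 := hg.dist_le_mul (e x).fst (e x₀).fst
    have h6 := mul_le_mul_of_nonneg_left h1 K.coe_nonneg
    rw [Real.dist_eq] at h5
    have h7 := abs_le.1 h5
    have h8 : (e x₀).snd - g (e x₀).fst = 0 := hτ0
    change s / 2 ≤ (e x).snd - g (e x).fst
    change 0 < (e x).snd - g (e x).fst at hx
    rcases le_abs.1 h3 with h | h <;> linarith [h7.1, h7.2]
  refine ⟨⟨τ, L, v, χ, T, ρ / 2, hτlip, hτv, hvn, hχ, hχc, hχ0, hχ1, by positivity, hχone,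
    fun x hx hxΩ => (hgraph' x (Metric.ball_subset_ball ?_ hx)).1 hxΩ,
    fun x hx => hdist x (Metric.closedBall_subset_ball ?_ (hχsupp x hx)), hTc, hTΩ, hχv⟩⟩
  · rw [hs_def] at hρs; linarith
  · rw [hs_def]; linarith

namespace BoundaryPatch

variable {Ω : Set R3} {x₀ : R3} (P : BoundaryPatch Ω x₀)

theorem measurableSet_lt_height (η : ℝ) : MeasurableSet {x | η < P.τ x} :=
  measurableSet_lt measurable_const P.lipschitz.continuous.measurable

/-- The cut off function `χ (f - c)` has a vertical derivative that is controlled by the weighted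
gradient of `f` and by the values of `f - c` on the compact set `T`. -/
theorem exists_height_mul_deriv_le : ∃ A : ℝ, 0 ≤ A ∧ ∀ (f : R3 → ℝ) (c ε : ℝ),
    ContDiff ℝ ∞ f → 0 < ε → ∀ x,
      ‖max (P.τ x - 4 * P.L * ε) 0 * fderiv ℝ (fun x => P.χ x * (f x - c)) x P.v‖ ≤
        P.L * (max (Metric.infDist x Ωᶜ - 4 * ε) 0 * ‖fderiv ℝ f x‖) +
          A * ‖P.T.indicator (fun x => f x - c) x‖ := by
  obtain ⟨B, hB⟩ := (P.hasCompactSupport.fderiv_apply ℝ P.v).exists_bound_of_continuous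
    ((P.contDiff.continuous_fderiv (by simp)).clm_apply continuous_const)
  obtain ⟨H, hH⟩ := P.isCompact.exists_bound_of_continuousOn P.lipschitz.continuous.continuousOn
  have hB0 : 0 ≤ B := (norm_nonneg _).trans (hB 0)
  refine ⟨max H 0 * B, by positivity, fun f c ε hf hε x => ?_⟩
  have hFv : fderiv ℝ (fun x => P.χ x * (f x - c)) x P.v =
      P.χ x * fderiv ℝ f x P.v + fderiv ℝ P.χ x P.v * (f x - c) := by
    have h1 : HasFDerivAt (fun x => P.χ x * (f x - c)) _ x :=
      (P.contDiff.differentiable (by simp) x).hasFDerivAt.mul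
        ((hf.differentiable (by simp) x).hasFDerivAt.sub_const c)
    rw [h1.fderiv]
    simp [mul_comm]
  have hL0 : (0 : ℝ) ≤ P.L := P.L.coe_nonneg
  have hLε : 0 ≤ 4 * P.L * ε := by positivity
  rw [hFv, norm_mul, Real.norm_of_nonneg (le_max_right _ _)]
  rcases le_or_gt (P.τ x - 4 * P.L * ε) 0 with h0 | h0
  · rw [max_eq_right h0, zero_mul]
    positivity
  rw [max_eq_left h0.le]
  have h1 : (P.τ x - 4 * P.L * ε) * ‖P.χ x * fderiv ℝ f x P.v‖ ≤
      P.L * (max (Metric.infDist x Ωᶜ - 4 * ε) 0 * ‖fderiv ℝ f x‖) := by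
    by_cases hχx : P.χ x = 0
    · rw [hχx, zero_mul, norm_zero, mul_zero]
      positivity
    have h2 : P.τ x - 4 * P.L * ε ≤ P.L * max (Metric.infDist x Ωᶜ - 4 * ε) 0 := by
      have := mul_le_mul_of_nonneg_left (le_max_left (Metric.infDist x Ωᶜ - 4 * ε) 0) hL0
      linarith [P.height_le x hχx]
    have h3 : ‖P.χ x * fderiv ℝ f x P.v‖ ≤ ‖fderiv ℝ f x‖ := by
      rw [norm_mul, Real.norm_of_nonneg (P.nonneg x), ← one_mul ‖fderiv ℝ f x‖]
      refine mul_le_mul (P.le_one x) ?_ (norm_nonneg _) zero_le_one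
      exact (ContinuousLinearMap.le_opNorm_of_le _ P.norm_v).trans_eq (mul_one _)
    rw [← mul_assoc]
    exact mul_le_mul h2 h3 (norm_nonneg _) (by positivity)
  have h2 : (P.τ x - 4 * P.L * ε) * ‖fderiv ℝ P.χ x P.v * (f x - c)‖ ≤
      max H 0 * B * ‖P.T.indicator (fun x => f x - c) x‖ := by
    by_cases hv0 : fderiv ℝ P.χ x P.v = 0
    · rw [hv0, zero_mul, norm_zero, mul_zero]
      positivity
    have hxT := P.mem_of_deriv x (by linarith) hv0
    have h3 : P.τ x - 4 * P.L * ε ≤ max H 0 :=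
      le_max_of_le_left (by linarith [hH x hxT, le_abs_self (P.τ x), Real.norm_eq_abs (P.τ x)])
    rw [indicator_of_mem hxT, norm_mul, ← mul_assoc]
    exact mul_le_mul_of_nonneg_right
      (mul_le_mul h3 (hB x) (norm_nonneg _) (le_max_right _ _)) (norm_nonneg _)
  refine (mul_le_mul_of_nonneg_left (norm_add_le _ _) h0.le).trans ?_
  rw [mul_add]
  exact add_le_add h1 h2

/-- Hardy's inequality on a boundary patch: above the height `4 L ε`, a smooth function is
controlled by its weighted gradient and its values on the compact set `T`. -/
theorem exists_eLpNorm_sub_const_le : ∃ A : ℝ≥0∞, A ≠ ⊤ ∧ ∀ (f : R3 → ℝ) (c ε : ℝ),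
    ContDiff ℝ ∞ f → 0 < ε →
      eLpNorm ({x | 4 * P.L * ε < P.τ x}.indicator fun x => f x - c) 2
          (volume.restrict (Metric.ball x₀ P.ρ)) ≤
        2 * (P.L * eLpNorm (fun x => max (Metric.infDist x Ωᶜ - 4 * ε) 0 * ‖fderiv ℝ f x‖) 2 volume
          + A * eLpNorm (fun x => f x - c) 2 (volume.restrict P.T)) := by
  obtain ⟨A, hA, hpt⟩ := P.exists_height_mul_deriv_le
  refine ⟨ENNReal.ofReal A, ENNReal.ofReal_ne_top, fun f c ε hf hε => ?_⟩
  set F : R3 → ℝ := fun x => P.χ x * (f x - c) with hF_def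
  have hF : ContDiff ℝ ∞ F := P.contDiff.mul (hf.sub contDiff_const)
  have hFc : HasCompactSupport F := P.hasCompactSupport.mul_right
  have hlip : LipschitzWith P.L fun x => P.τ x - 4 * P.L * ε :=
    LipschitzWith.of_le_add_mul P.L fun x y => by
      have := P.lipschitz.dist_le_mul x y
      rw [Real.dist_eq] at this
      linarith [(abs_le.1 this).2]
  have hhardy := eLpNorm_le_two_mul_eLpNorm_height_mul hlip (v := P.v)
    (fun x t => by rw [P.height_add]; ring) hF hFc
  have hleft : eLpNorm ({x | 4 * P.L * ε < P.τ x}.indicator fun x => f x - c) 2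
      (volume.restrict (Metric.ball x₀ P.ρ)) ≤
      eLpNorm F 2 (volume.restrict {x | 0 < P.τ x - 4 * P.L * ε}) := by
    simp only [sub_pos]
    rw [← eLpNorm_indicator_eq_eLpNorm_restrict (P.measurableSet_lt_height _)]
    refine (eLpNorm_mono_ae ?_).trans (eLpNorm_mono_measure _ Measure.restrict_le_self)
    filter_upwards [ae_restrict_mem measurableSet_ball] with x hx
    by_cases hxτ : x ∈ {x | 4 * P.L * ε < P.τ x}
    · rw [indicator_of_mem hxτ, indicator_of_mem hxτ, hF_def]
      simp only [P.eq_one x hx, one_mul, le_refl]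
    · rw [indicator_of_notMem hxτ, indicator_of_notMem hxτ]
  set W : R3 → ℝ := fun x => max (Metric.infDist x Ωᶜ - 4 * ε) 0 * ‖fderiv ℝ f x‖ with hW_def
  set G : R3 → ℝ := P.T.indicator fun x => f x - c with hG_def
  have hWm : AEStronglyMeasurable W volume :=
    ((((Metric.continuous_infDist_pt _).sub continuous_const).max continuous_const).mul
      (hf.continuous_fderiv (by simp)).norm).aestronglyMeasurable
  have hGm : AEStronglyMeasurable G volume :=
    ((hf.continuous.sub continuous_const).stronglyMeasurable.indicator
      P.isCompact.measurableSet).aestronglyMeasurable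
  have eW : eLpNorm (fun x => (P.L : ℝ) * W x) 2 volume = P.L * eLpNorm W 2 volume := by
    have := eLpNorm_const_smul (P.L : ℝ) W 2 volume
    rwa [Real.enorm_of_nonneg P.L.coe_nonneg, ENNReal.ofReal_coe_nnreal] at this
  have eG : eLpNorm (fun x => A * ‖G x‖) 2 volume =
      ENNReal.ofReal A * eLpNorm (fun x => f x - c) 2 (volume.restrict P.T) := by
    have := eLpNorm_const_smul A (fun x => ‖G x‖) 2 volume
    rwa [Real.enorm_of_nonneg hA, eLpNorm_norm, hG_def,
      eLpNorm_indicator_eq_eLpNorm_restrict P.isCompact.measurableSet] at this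
  refine (hleft.trans hhardy).trans ?_
  gcongr 2 * ?_
  refine (eLpNorm_mono_real (hpt f c ε hf hε)).trans ?_
  rw [← eW, ← eG]
  exact eLpNorm_add_le (hWm.const_mul _) (hGm.norm.const_mul _) (by norm_num)

end BoundaryPatch

/-- Near the boundary, the Poincaré inequality is inherited from compact subsets of `Ω`. -/
theorem exists_poincareOn_boundary {Ω : Set R3} (hne : Ωᶜ.Nonempty)
    (ho : IsOpen Ω) (hlip : HasLipschitzBoundary Ω)
    (hcpt : ∀ K ⊆ Ω, IsCompact K → ∃ U, IsOpen U ∧ K ⊆ U ∧ PoincareOn Ω U) {x₀ : R3}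
    (hx₀ : x₀ ∈ frontier Ω) : ∃ ρ > 0, PoincareOn Ω (Metric.ball x₀ ρ ∩ Ω) := by
  obtain ⟨P⟩ := nonempty_boundaryPatch hne ho hlip hx₀
  obtain ⟨A, hA, hP⟩ := P.exists_eLpNorm_sub_const_le
  obtain ⟨U, hUo, hTU, C, hC, hU⟩ := hcpt P.T P.subset P.isCompact
  obtain ⟨δ, hδ, hδU⟩ := P.isCompact.exists_thickening_subset_open hUo hTU
  refine ⟨P.ρ, P.ρ_pos, 2 * (P.L + A * C), by finiteness, fun q M hqm hq hM => ?_⟩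
  obtain ⟨c, hc⟩ := hU q M hqm hq hM
  refine ⟨c, ?_⟩
  have hql : LocallyIntegrable q := hq.locallyIntegrable (by norm_num)
  have hf : ∀ n, ContDiff ℝ ∞ (mollify (bumpSeq n) q) := fun n => contDiff_mollify (bumpSeq n) hql
  have hηlim : Filter.Tendsto (fun n => 4 * P.L * (bumpSeq n).rOut) Filter.atTop (nhds 0) := by
    simpa using tendsto_bumpSeq_rOut.const_mul (4 * (P.L : ℝ))
  refine eLpNorm_le_of_tendsto (F := fun n => {x | 4 * P.L * (bumpSeq n).rOut < P.τ x}.indicator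
    fun x => mollify (bumpSeq n) q x - c) (fun n => ?_) ?_ ?_
  · exact (((hf n).continuous.sub continuous_const).stronglyMeasurable.indicator
      (P.measurableSet_lt_height _)).aestronglyMeasurable
  · filter_upwards [ae_restrict_of_ae (ae_tendsto_mollify_bumpSeq hql),
      ae_restrict_mem (measurableSet_ball.inter ho.measurableSet)] with x hx hxN
    refine (hx.sub_const c).congr' ?_
    filter_upwards [hηlim.eventually_lt_const (P.height_pos x hxN.1 hxN.2)] with n hn
    symm
    exact indicator_of_mem (s := {x | 4 * P.L * (bumpSeq n).rOut < P.τ x}) hn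
      fun x => mollify (bumpSeq n) q x - c
  · filter_upwards [tendsto_bumpSeq_rOut.eventually_lt_const hδ] with n hn
    refine (eLpNorm_mono_measure _ (Measure.restrict_mono inter_subset_left le_rfl)).trans
      ((hP _ c _ (hf n) (bumpSeq n).rOut_pos).trans ?_)
    rw [mul_assoc, add_mul, mul_assoc A]
    gcongr
    · exact hM (bumpSeq n)
    · exact (eLpNorm_mollify_sub_const_le (bumpSeq n) hqm hql c P.isCompact.measurableSet
        hUo.measurableSet ((Metric.thickening_mono hn.le _).trans hδU)).trans hc

/-! ### The improved Poincaré inequality on Lipschitz domains -/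

section Connected

variable {Ω : Set R3}

theorem PoincareOn.union_of_mem {U V : Set R3} (hΩb : Bornology.IsBounded Ω)
    (hU : PoincareOn Ω U) (hV : PoincareOn Ω V) (hUo : IsOpen U) (hVo : IsOpen V) (hVΩ : V ⊆ Ω)
    {x : R3} (hxU : x ∈ U) (hxV : x ∈ V) : PoincareOn Ω (U ∪ V) :=
  hU.union hV ((hUo.inter hVo).measure_pos volume ⟨x, hxU, hxV⟩).ne'
    (hΩb.subset hVΩ).measure_lt_top.ne

theorem exists_poincareOn_pair (hΩb : Bornology.IsBounded Ω) (ho : IsOpen Ω)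
    (hΩc : IsConnected Ω) (hne : Ωᶜ.Nonempty) {x y : R3} (hx : x ∈ Ω) (hy : y ∈ Ω) :
    ∃ U, IsOpen U ∧ U ⊆ Ω ∧ x ∈ U ∧ y ∈ U ∧ PoincareOn Ω U := by
  refine hΩc.isPreconnected.induction₂
    (fun x y => ∃ U, IsOpen U ∧ U ⊆ Ω ∧ x ∈ U ∧ y ∈ U ∧ PoincareOn Ω U) ?_ ?_ ?_ hx hy
  · intro x hx
    obtain ⟨r, hr, hrΩ, hP⟩ := exists_poincareOn_ball ho hne hx
    filter_upwards [mem_nhdsWithin_of_mem_nhds (Metric.ball_mem_nhds x hr)] with y hy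
    exact ⟨_, Metric.isOpen_ball, hrΩ, Metric.mem_ball_self hr, hy, hP⟩
  · rintro x y z - - - ⟨U, hUo, hUΩ, hxU, hyU, hU⟩ ⟨V, hVo, hVΩ, hyV, hzV, hV⟩
    exact ⟨U ∪ V, hUo.union hVo, union_subset hUΩ hVΩ, Or.inl hxU, Or.inr hzV,
      hU.union_of_mem hΩb hV hUo hVo hVΩ hyU hyV⟩
  · rintro x y - - ⟨U, hUo, hUΩ, hxU, hyU, hU⟩
    exact ⟨U, hUo, hUΩ, hyU, hxU, hU⟩

theorem exists_poincareOn_of_isCompact (hΩb : Bornology.IsBounded Ω) (ho : IsOpen Ω)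
    (hΩc : IsConnected Ω) (hne : Ωᶜ.Nonempty) {K : Set R3} (hK : IsCompact K)
    (hloc : ∀ x ∈ K, ∃ ρ > 0, PoincareOn Ω (Metric.ball x ρ ∩ Ω)) (hKΩ : K ⊆ closure Ω) :
    ∃ U, IsOpen U ∧ K ∩ Ω ⊆ U ∧ PoincareOn Ω U := by
  obtain ⟨x₀, hx₀⟩ := hΩc.nonempty
  suffices h : ∃ U, IsOpen U ∧ U ⊆ Ω ∧ x₀ ∈ U ∧ K ∩ Ω ⊆ U ∧ PoincareOn Ω U by
    obtain ⟨U, h1, -, -, h2, h3⟩ := h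
    exact ⟨U, h1, h2, h3⟩
  refine hK.induction_on
    (p := fun S => ∃ U, IsOpen U ∧ U ⊆ Ω ∧ x₀ ∈ U ∧ S ∩ Ω ⊆ U ∧ PoincareOn Ω U) ?_ ?_ ?_ ?_
  · obtain ⟨U, hUo, hUΩ, hxU, -, hU⟩ := exists_poincareOn_pair hΩb ho hΩc hne hx₀ hx₀
    exact ⟨U, hUo, hUΩ, hxU, by simp, hU⟩
  · rintro S S' hS ⟨U, hUo, hUΩ, hxU, hSU, hU⟩
    exact ⟨U, hUo, hUΩ, hxU, (inter_subset_inter_left _ hS).trans hSU, hU⟩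
  · rintro S S' ⟨U, hUo, hUΩ, hxU, hSU, hU⟩ ⟨V, hVo, hVΩ, hxV, hSV, hV⟩
    refine ⟨U ∪ V, hUo.union hVo, union_subset hUΩ hVΩ, Or.inl hxU, ?_,
      hU.union_of_mem hΩb hV hUo hVo hVΩ hxU hxV⟩
    rw [union_inter_distrib_right]
    exact union_subset_union hSU hSV
  · intro x hx
    obtain ⟨ρ, hρ, hP⟩ := hloc x hx
    obtain ⟨y, hyρ, hyΩ⟩ := mem_closure_iff_nhds.1 (hKΩ hx) _ (Metric.ball_mem_nhds x hρ)
    obtain ⟨V, hVo, hVΩ, hx₀V, hyV, hV⟩ := exists_poincareOn_pair hΩb ho hΩc hne hx₀ hyΩ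
    refine ⟨Metric.ball x ρ, mem_nhdsWithin_of_mem_nhds (Metric.ball_mem_nhds x hρ),
      V ∪ Metric.ball x ρ ∩ Ω, hVo.union (Metric.isOpen_ball.inter ho),
      union_subset hVΩ inter_subset_right, Or.inl hx₀V, subset_union_right, ?_⟩
    exact hV.union_of_mem hΩb hP hVo (Metric.isOpen_ball.inter ho) inter_subset_right hyV
      ⟨hyρ, hyΩ⟩

/-- The improved Poincaré inequality `‖q - c‖ ≤ C ‖dist(·, Ωᶜ) ∇q‖` on bounded connected Lipschitz
domains. -/
theorem poincareOn_self (hΩb : Bornology.IsBounded Ω) (ho : IsOpen Ω)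
    (hΩc : IsConnected Ω) (hlip : HasLipschitzBoundary Ω) : PoincareOn Ω Ω := by
  have hne : Ωᶜ.Nonempty := by
    rw [nonempty_compl]
    rintro rfl
    exact NormedSpace.unbounded_univ ℝ R3 hΩb
  have hint : ∀ x ∈ Ω, ∃ ρ > 0, PoincareOn Ω (Metric.ball x ρ ∩ Ω) := fun x hx => by
    obtain ⟨r, hr, -, hP⟩ := exists_poincareOn_ball ho hne hx
    exact ⟨r, hr, hP.mono inter_subset_left⟩
  have hcpt : ∀ K ⊆ Ω, IsCompact K → ∃ U, IsOpen U ∧ K ⊆ U ∧ PoincareOn Ω U := fun K hKΩ hK => by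
    obtain ⟨U, hUo, hKU, hU⟩ := exists_poincareOn_of_isCompact hΩb ho hΩc hne hK
      (fun x hx => hint x (hKΩ hx)) (hKΩ.trans subset_closure)
    exact ⟨U, hUo, fun x hx => hKU ⟨hx, hKΩ hx⟩, hU⟩
  obtain ⟨U, -, hΩU, hU⟩ := exists_poincareOn_of_isCompact hΩb ho hΩc hne hΩb.isCompact_closure
    (fun x hx => by
      by_cases hxΩ : x ∈ Ω
      · exact hint x hxΩ
      · exact exists_poincareOn_boundary hne ho hlip hcpt
          (by rw [ho.frontier_eq]; exact ⟨hx, hxΩ⟩)) subset_rfl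
  exact hU.mono fun x hx => hΩU ⟨subset_closure hx, hx⟩

end Connected

/-! ### The pressure bound -/

/-- The pressure bound `‖q‖ ≤ C (‖θ‖ + ‖√ν curl θ + ∇q‖)` on `𝒱`. -/
theorem exists_norm_press_le {Ω : Opens R3} (hΩ : Bornology.IsBounded (Ω : Set R3))
    (hΩc : IsConnected (Ω : Set R3)) (hlip : HasLipschitzBoundary (Ω : Set R3)) (ν : ℝ) {σ : ℝ}
    (hσ : 0 < σ) :
    ∃ C : ℝ, ∀ u : Space Ω ν σ hσ, ‖u.press‖ ≤ C * (‖u.vort‖ + ‖u.curlGrad‖) := by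
  obtain ⟨R, hR, hM⟩ := exists_weightedGradBound hΩ ν
  obtain ⟨C, hC, hP⟩ := poincareOn_self hΩ Ω.isOpen hΩc hlip
  have hfin : IsFiniteMeasure (volume.restrict (Ω : Set R3)) :=
    isFiniteMeasure_restrict.2 hΩ.measure_lt_top.ne
  refine ⟨C.toReal * (R + 2 * √ν), fun u => ?_⟩
  set q := u.press with hq_def
  set M := R * ‖u.curlGrad‖ + 2 * √ν * ‖u.vort‖ with hM_def
  have hM0 : 0 ≤ M := by positivity
  have hΩm := Ω.isOpen.measurableSet
  obtain ⟨c, hc⟩ := hP ((Ω : Set R3).indicator q) (Real.toNNReal M)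
    ((Lp.stronglyMeasurable q).indicator hΩm)
    ((memLp_indicator_iff_restrict hΩm).2 (Lp.memLp q))
    (hM u.vort q u.curlGrad u.curlGrad_spec)
  have hcm : MemLp (fun _ : R3 => c) 2 (volume.restrict (Ω : Set R3)) := memLp_const c
  have hsub : ‖q - hcm.toLp _‖ ≤ C.toReal * M := by
    have h1 : ‖q - hcm.toLp _‖ = (eLpNorm (fun x => (Ω : Set R3).indicator q x - c) 2
        (volume.restrict (Ω : Set R3))).toReal := by
      rw [Lp.norm_def]
      congr 1
      refine eLpNorm_congr_ae ?_
      filter_upwards [Lp.coeFn_sub q (hcm.toLp _), hcm.coeFn_toLp, ae_restrict_mem hΩm]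
        with x h1 h2 h3
      rw [h1, Pi.sub_apply, h2, indicator_of_mem h3]
    rw [h1]
    refine (ENNReal.toReal_mono (by finiteness) hc).trans (le_of_eq ?_)
    rw [ENNReal.toReal_mul, ENNReal.coe_toReal, Real.coe_toNNReal _ hM0]
  -- as `q` has mean value zero, it is orthogonal to the constants
  have horth : inner ℝ q (hcm.toLp _) = 0 := by
    have h0 : ∫ x in (Ω : Set R3), q x = 0 := (Subtype.property u).1.2
    rw [L2.inner_def]
    have : ∫ x in (Ω : Set R3), inner ℝ (q x) (hcm.toLp _ x) = ∫ x in (Ω : Set R3), c * q x := by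
      refine integral_congr_ae ?_
      filter_upwards [hcm.coeFn_toLp] with x hx
      rw [hx]
      simp
    rw [this, integral_const_mul, h0, mul_zero]
  have hq : ‖q‖ ≤ ‖q - hcm.toLp _‖ := by
    rcases (norm_nonneg q).eq_or_lt with h0 | h0
    · rw [← h0]; positivity
    refine le_of_mul_le_mul_left ?_ h0
    have h1 := real_inner_le_norm q (q - hcm.toLp _)
    rwa [inner_sub_right, horth, sub_zero, real_inner_self_eq_norm_mul_norm] at h1
  refine hq.trans (hsub.trans ?_)
  rw [mul_assoc]
  refine mul_le_mul_of_nonneg_left ?_ ENNReal.toReal_nonneg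
  have h1 := mul_nonneg hR (norm_nonneg u.vort)
  have h2 := mul_nonneg (Real.sqrt_nonneg ν) (norm_nonneg u.curlGrad)
  rw [hM_def]
  linarith

end Oseen

theorem theorem2p4 (Ω : TopologicalSpace.Opens Oseen.R3)
    (hΩ_bdd : Bornology.IsBounded (Ω : Set Oseen.R3))
    (hΩ_conn : IsConnected (Ω : Set Oseen.R3))
    (hΩ_lip : Oseen.HasLipschitzBoundary (Ω : Set Oseen.R3))
    (ν σ : ℝ) (hν : 0 < ν) (hσ : 0 < σ)
    (β : Oseen.LinftyVec Ω) (hβ : 2 * ‖β‖ ^ 2 < ν * σ) :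
    CompleteSpace (Oseen.Space Ω ν σ hσ) ∧
    (∀ f : Oseen.L2Vec Ω, ∃! u : Oseen.Space Ω ν σ hσ, Oseen.IsWeakSolution β f u) ∧
    ∃ C : ℝ, 0 < C ∧ ∀ (f₁ f₂ : Oseen.L2Vec Ω) (u₁ u₂ : Oseen.Space Ω ν σ hσ),
      Oseen.IsWeakSolution β f₁ u₁ → Oseen.IsWeakSolution β f₂ u₂ →
        ‖u₁ - u₂‖ ≤ C * ‖f₁ - f₂‖ := by
  obtain ⟨C, hC⟩ := Oseen.exists_norm_press_le hΩ_bdd hΩ_conn hΩ_lip ν hσ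
  exact ⟨Oseen.Space.completeSpace hΩ_bdd, Oseen.wellPosed_of_norm_press_le hΩ_bdd hν hβ hC⟩
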